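/- Let $G=\mathrm{SL}_3(\mathbb R)$, $\Gamma=\mathrm{SL}_3(\mathbb Z)$, $X_3=G/\Gamma$ (the space of unimodular lattices in $\mathbb R^3$, where $g\Gamma$ is the lattice spanned by the columns of $g$), let $e_\Gamma\in X_3$ be the identity coset, and let $A<G$ be the group of diagonal matrices with positive diagonal entries. A point $x\in X_3$ is called $A$-regular if $\overline{Ax}=Lx$ for some closed subgroup $L$ of $G$ with $A\le L\le G$, and $A$-irregular otherwise. For $v=(\alpha,\beta)^t\in\mathbb R^2$ let $x_v=h_ve_\Gamma$ and $z_v=g_ve_\Gamma$, where $$h_v=\begin{pmatrix}1&0&0\\ \alpha&1&0\\ \beta&0&1\end{pmatrix},\qquad g_v=\begin{pmatrix}1&\alpha&\beta\\ 0&1&0\\ 0&0&1\end{pmatrix}.$$ For a positive integer $q$ let $$M^{(1)}_q=H^{(1)}\begin{pmatrix}1&0&0\\0&1&0\\q^{-1}&0&1\end{pmatrix}e_\Gamma,\qquad M^{(2)}_q=H^{(2)}\begin{pmatrix}1&0&0\\q^{-1}&1&0\\0&0&1\end{pmatrix}e_\Gamma,$$ where $H^{(1)}$ and $H^{(2)}$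 are the subgroups of $G$ of matrices of the forms $\begin{pmatrix}*&*&0\\ *&*&0\\0&0&*\end{pmatrix}$ and $\begin{pmatrix}*&0&*\\0&*&0\\ *&0&*\end{pmatrix}$, respectively. Let $a^{(1)}(t)=\mathrm{diag}(e^{-t},e^t,1)$ and $a^{(2)}(t)=\mathrm{diag}(e^{-t},1,e^t)$. Distances in $A$ are Euclidean distances between the vectors of logarithms of the diagonal entries. Theorem. Let $v=(\alpha,\beta)^t\in\mathbb R^2$ with $\alpha,\beta$ irrational and $1,\alpha,\beta$ linearly dependent over $\mathbb Q$. Then one can write $\beta=\frac{p_1}{q}\alpha+\frac{p_2}{q}$ and $\alpha=\frac{p_1'}{q'}\beta+\frac{p_2'}{q'}$ in reduced forms, i.e. with $q,q'$ positive integers and integers $p_1,p_2$ (resp. $p_1',p_2'$) whose classes generate $\mathbb Z/q\mathbb Z$ (resp. $\mathbb Z/q'\mathbb Z$), and for any such reduced forms the following holds. 1. The sets $M^{(1)}_q$ and $M^{(2)}_{q'}$ are closed in $X_3$, and the orbit $Ax_v$ is disjoint from $M^{(1)}_q\cup M^{(2)}_{q'}$. 2. If $a_n\in A$ is a sequence whose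 distance to the union of the two rays $\{a^{(i)}(t)\}_{t>0}$, $i=1,2$, goes to $\infty$, then the sequence $a_nx_v$ diverges, i.e. it has no converging subsequence in $X_3$. 3. Let $\Omega_i=\overline{\{a^{(i)}(t)x_v\}_{t\ge0}}\setminus\{a^{(i)}(t)x_v\}_{t\ge0}$ and $A\Omega_i=\bigcup_{a\in A}a\Omega_i$. Then $\overline{Ax_v}\setminus Ax_v=A\Omega_1\cup A\Omega_2$, and $A\Omega_i\neq\emptyset$ for $i=1,2$. 4. $A\Omega_1\subset M^{(1)}_q$ and $A\Omega_2\subset M^{(2)}_{q'}$. In particular, $x_v$ and $z_v$ are $A$-irregular. -/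

import Mathlib

open Filter Topology Set

noncomputable section

namespace AIrregular

/-- `G = SL₃(ℝ)`. -/
abbrev G : Type := Matrix.SpecialLinearGroup (Fin 3) ℝ

/-- `Γ = SL₃(ℤ)`, as a subgroup of `G`. -/
def Gam : Subgroup G :=
  (Matrix.SpecialLinearGroup.map (n := Fin 3) (Int.castRingHom ℝ)).range

/-- `X₃ = G / Γ` with the quotient topology and the left action of `G`; the coset `gΓ` is the
unimodular lattice spanned by the columns of `g`. -/
abbrev X3 : Type := G ⧸ Gam

/-- The identity coset, i.e. the standard lattice `ℤ³`. -/
def eGam : X3 := ((1 : G) : G ⧸ Gam)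

/-- The group `A` of diagonal matrices with positive diagonal entries and determinant one. -/
def A : Subgroup G where
  carrier := {g | ∃ t : Fin 3 → ℝ, ∑ i, t i = 0 ∧
    (g : Matrix (Fin 3) (Fin 3) ℝ) = Matrix.diagonal fun i => Real.exp (t i)}
  one_mem' := ⟨0, by simp, by simp⟩
  mul_mem' := by
    rintro g h ⟨t, ht, hg⟩ ⟨s, hs, hh⟩
    refine ⟨t + s, by simp [Finset.sum_add_distrib, ht, hs], ?_⟩
    simp [hg, hh, Real.exp_add]
  inv_mem' := by
    rintro g ⟨t, ht, hg⟩
    refine ⟨-t, by simp [ht], ?_⟩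
    rw [Fin.sum_univ_three] at ht
    rw [Matrix.SpecialLinearGroup.coe_inv, hg, Matrix.adjugate_fin_three]
    have h0 : -t 0 = t 1 + t 2 := by linarith
    have h1 : -t 1 = t 0 + t 2 := by linarith
    have h2 : -t 2 = t 0 + t 1 := by linarith
    ext i j
    fin_cases i <;> fin_cases j <;> simp [h0, h1, h2, Real.exp_add]

/-- The block group of matrices `(* * 0; * * 0; 0 0 *)` in `G`. -/
def H₁ : Subgroup G where
  carrier := {g | g 0 2 = 0 ∧ g 1 2 = 0 ∧ g 2 0 = 0 ∧ g 2 1 = 0}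
  one_mem' := by simp
  mul_mem' := by
    rintro g h ⟨g1, g2, g3, g4⟩ ⟨h1, h2, h3, h4⟩
    simp [Matrix.mul_apply, Fin.sum_univ_three, *]
  inv_mem' := by
    rintro g ⟨g1, g2, g3, g4⟩
    simp [Matrix.SpecialLinearGroup.coe_inv, Matrix.adjugate_fin_three, *]

/-- The block group of matrices `(* 0 *; 0 * 0; * 0 *)` in `G`. -/
def H₂ : Subgroup G where
  carrier := {g | g 0 1 = 0 ∧ g 1 0 = 0 ∧ g 1 2 = 0 ∧ g 2 1 = 0}
  one_mem' := by simp
  mul_mem' := by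
    rintro g h ⟨g1, g2, g3, g4⟩ ⟨h1, h2, h3, h4⟩
    simp [Matrix.mul_apply, Fin.sum_univ_three, *]
  inv_mem' := by
    rintro g ⟨g1, g2, g3, g4⟩
    simp [Matrix.SpecialLinearGroup.coe_inv, Matrix.adjugate_fin_three, *]

/-- The lower triangular matrix `h_{(a,b)}`. -/
def hMat (a b : ℝ) : G :=
  ⟨!![1, 0, 0; a, 1, 0; b, 0, 1], by simp [Matrix.det_fin_three]⟩

/-- The upper triangular matrix `g_{(a,b)}`. -/
def gMat (a b : ℝ) : G :=
  ⟨!![1, a, b; 0, 1, 0; 0, 0, 1], by simp [Matrix.det_fin_three]⟩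

/-- The lattice `x_v` spanned by the columns of `h_v`, for `v = (a, b)`. -/
def xPt (a b : ℝ) : X3 := hMat a b • eGam

/-- The lattice `z_v` spanned by the columns of `g_v`, for `v = (a, b)`. -/
def zPt (a b : ℝ) : X3 := gMat a b • eGam

/-- The orbit `M⁽¹⁾_q` of `H₁` through the lattice with basis matrix `(1 0 0; 0 1 0; 1/q 0 1)`. -/
def M₁ (q : ℕ) : Set X3 := MulAction.orbit H₁ (hMat 0 ((q : ℝ)⁻¹) • eGam)

/-- The orbit `M⁽²⁾_q` of `H₂` through the lattice with basis matrix `(1 0 0; 1/q 1 0; 0 0 1)`. -/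
def M₂ (q : ℕ) : Set X3 := MulAction.orbit H₂ (hMat ((q : ℝ)⁻¹) 0 • eGam)

/-- `a⁽¹⁾(t) = diag(e⁻ᵗ, eᵗ, 1)`. -/
def a₁ (t : ℝ) : G :=
  ⟨Matrix.diagonal ![Real.exp (-t), Real.exp t, 1], by
    simp [Matrix.det_diagonal, Fin.prod_univ_three, ← Real.exp_add]⟩

/-- `a⁽²⁾(t) = diag(e⁻ᵗ, 1, eᵗ)`. -/
def a₂ (t : ℝ) : G :=
  ⟨Matrix.diagonal ![Real.exp (-t), 1, Real.exp t], by
    simp [Matrix.det_diagonal, Fin.prod_univ_three, ← Real.exp_add]⟩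

/-- Logarithmic coordinates on `A`: the logarithms of the diagonal entries, as a Euclidean vector.
The Euclidean distance of these vectors is an invariant Riemannian distance on `A`. -/
def logCoord (a : G) : EuclideanSpace ℝ (Fin 3) :=
  WithLp.toLp 2 fun i => Real.log (a i i)

/-- The distance, in `A`, from `a` to a set `S` of elements of `A`. -/
def distA (a : G) (S : Set G) : ℝ := Metric.infDist (logCoord a) (logCoord '' S)

/-- The union of the two open rays `{a⁽ⁱ⁾(t) : t > 0}`, `i = 1, 2`. -/
def rays : Set G := a₁ '' Ioi 0 ∪ a₂ '' Ioi 0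

/-- The forward trajectory `{c(t) x : t ≥ 0}`. -/
def traj (c : ℝ → G) (x : X3) : Set X3 := (fun t => c t • x) '' Ici 0

/-- The set of points in the closure of the forward trajectory that are not on the trajectory. -/
def Om (c : ℝ → G) (x : X3) : Set X3 := closure (traj c x) \ traj c x

/-- `A S`, the union of the translates `a S` over `a ∈ A`. -/
def ASat (S : Set X3) : Set X3 := {y | ∃ a ∈ A, ∃ w ∈ S, a • w = y}

/-- The point `x` is `H`-regular: the closure of `H x` is an orbit `L x` of a closed subgroup
`L` of `G` that contains `H`. -/
def IsRegularPt (H : Subgroup G) (x : X3) : Prop :=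
  ∃ L : Subgroup G, IsClosed (L : Set G) ∧ H ≤ L ∧
    closure (MulAction.orbit H x) = MulAction.orbit L x

/-- `y = (p₁ / q) x + p₂ / q` is a reduced form: `q` is a positive integer and the classes of the
integers `p₁, p₂` generate `ℤ/qℤ`. -/
def IsReducedForm (y x : ℝ) (q : ℕ) (p₁ p₂ : ℤ) : Prop :=
  0 < q ∧ y = (p₁ : ℝ) / q * x + (p₂ : ℝ) / q ∧
    AddSubgroup.closure {(p₁ : ZMod q), (p₂ : ZMod q)} = ⊤

end AIrregular

end

/-!
The lattice `x_v` consists of the vectors `(m, α m + k, β m + l)`, with `m`, `k`, `l` integers.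

**Closed orbits.** `H₁` is the centralizer of the projection `E₃₃`, so `k Γ` lies in the
`H₁`-orbit of `g Γ` exactly if `k⁻¹ E₃₃ k` is `Γ`-conjugate to `g⁻¹ E₃₃ g` (`mk_mem_orbit_iff`).
For the base point of `M⁽¹⁾_q` these conjugates have entries in `(1/q) ℤ`, hence form a closed
set, and `M⁽¹⁾_q` is closed (`isClosed_orbit`). The elements of `A` commute with the `Eᵢᵢ`, and
`h_v⁻¹ Eᵢᵢ h_v` has an irrational entry, so `A x_v` misses `M⁽¹⁾_q` and `M⁽²⁾_{q'}`
(`disjoint_orbit_xPt`).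

**Divergence.** Near a given point of `X₃` lattices have no short vectors
(`exists_forall_le_abs_mulVec`). If `a x_v` has none, for `a = diag(exp s)`, then the vectors with
`m = 0` bound `s 1` and `s 2` from below. The vectors in the plane `z = (p₁ / q) y`, which is
rational for `x_v` because `β = (p₁ / q) α + p₂ / q`, form a planar lattice whose covolume `a`
multiplies by about `exp (- min (s 1) (s 2))`; so this minimum is bounded as well
(`exists_bound_of_no_short_vector`) and `a` is at bounded distance from one of the two rays
(`exists_mem_boxA_mul`). This gives the divergence statement, and, with the compactness of bounded
subsets of `A`, the description of the closure of the orbit (`closure_orbit_diff`).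

**Limit points.** The relation between `α` and `β` also shows that `x_v` is a shear, by `p₁ / q`
in the entry `(3, 2)`, of a lattice in `M⁽¹⁾_q` (`mk_mem_M₁`). The flow `a⁽¹⁾(t)` contracts this
shear, so its limit points are in the closed set `M⁽¹⁾_q` (`Om_a₁_subset_M₁`). There are such
limit points: a rational approximation of `α` with error below the inverse square of its
denominator extends to a basis of `x_v` that `a⁽¹⁾(t)` takes, at a suitable time, to a bounded one
(`exists_a₁_smul_mem`). Exchanging the last two coordinates carries all of this over to `a⁽²⁾`.

**Irregularity.** If the closure of `A x_v` were `L x_v`, then some `g ∈ L` would take `x_v` into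
`M⁽¹⁾_q`. As `A x_v` is relatively open in the closure and `Γ` is countable, `g` would conjugate
some diagonal matrix with distinct entries to a diagonal matrix. Then `g` permutes the axes, so
`(g h_v)⁻¹ E₃₃ g h_v` is one of the `h_v⁻¹ Eᵢᵢ h_v`, which are irrational (`not_isRegularPt_xPt`).
The inverse transpose automorphism takes `x_{-v}` to `z_v`.
-/

namespace AIrregular

/-! ### Conjugates of coordinate projections -/

/-- The rank one projection `k⁻¹ Eᵢᵢ k`, where `Eᵢᵢ` is the projection to the `i`-th axis. Indices
in `Fin 3` start at zero, so the projection `E₃₃` belongs to `i = 2`. -/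
noncomputable def projConj (i : Fin 3) (k : G) : Matrix (Fin 3) (Fin 3) ℝ :=
  ((k⁻¹ : G) : Matrix (Fin 3) (Fin 3) ℝ) * Matrix.single i i 1 * (k : Matrix (Fin 3) (Fin 3) ℝ)

lemma projConj_apply (i : Fin 3) (k : G) (r c : Fin 3) :
    projConj i k r c = (k⁻¹ : G) r i * k i c := by
  simp only [projConj, Matrix.mul_apply, Matrix.single_apply, Fin.sum_univ_three]
  fin_cases i <;> simp

lemma coe_mul_coe_inv (k : G) :
    (k : Matrix (Fin 3) (Fin 3) ℝ) * ((k⁻¹ : G) : Matrix (Fin 3) (Fin 3) ℝ) = 1 := by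
  rw [← Matrix.SpecialLinearGroup.coe_mul, mul_inv_cancel, Matrix.SpecialLinearGroup.coe_one]

lemma coe_inv_mul_coe (k : G) :
    ((k⁻¹ : G) : Matrix (Fin 3) (Fin 3) ℝ) * (k : Matrix (Fin 3) (Fin 3) ℝ) = 1 := by
  rw [← Matrix.SpecialLinearGroup.coe_mul, inv_mul_cancel, Matrix.SpecialLinearGroup.coe_one]

lemma projConj_mul (i : Fin 3) (k g : G) :
    projConj i (k * g) =
      ((g⁻¹ : G) : Matrix (Fin 3) (Fin 3) ℝ) * projConj i k *
        (g : Matrix (Fin 3) (Fin 3) ℝ) := by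
  simp only [projConj, mul_inv_rev, Matrix.SpecialLinearGroup.coe_mul, Matrix.mul_assoc]

/-- Two elements of `G` have the same `projConj i` exactly if they differ by an element of the
centralizer of the projection to the `i`-th axis. -/
lemma projConj_eq_iff (i : Fin 3) (k g : G) :
    projConj i k = projConj i g ↔
      ((k * g⁻¹ : G) : Matrix (Fin 3) (Fin 3) ℝ) * Matrix.single i i 1 =
        Matrix.single i i 1 * ((k * g⁻¹ : G) : Matrix (Fin 3) (Fin 3) ℝ) := by
  simp only [projConj, Matrix.SpecialLinearGroup.coe_mul]
  generalize Matrix.single i i (1 : ℝ) = E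
  have hk := coe_mul_coe_inv k
  have hk' := coe_inv_mul_coe k
  have hg := coe_mul_coe_inv g
  have hg' := coe_inv_mul_coe g
  generalize ((k⁻¹ : G) : Matrix (Fin 3) (Fin 3) ℝ) = K' at *
  generalize ((g⁻¹ : G) : Matrix (Fin 3) (Fin 3) ℝ) = G' at *
  generalize (k : Matrix (Fin 3) (Fin 3) ℝ) = K at *
  generalize (g : Matrix (Fin 3) (Fin 3) ℝ) = G₀ at *
  constructor
  · intro h
    calc K * G' * E = K * (G' * E * G₀) * G' := by
          simp only [Matrix.mul_assoc, hg, Matrix.mul_one]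
      _ = K * (K' * E * K) * G' := by rw [h]
      _ = (K * K') * E * K * G' := by simp only [Matrix.mul_assoc]
      _ = E * (K * G') := by rw [hk, Matrix.one_mul, Matrix.mul_assoc]
  · intro h
    calc K' * E * K = K' * (E * (K * G')) * G₀ := by
          simp only [Matrix.mul_assoc, hg', Matrix.mul_one]
      _ = K' * (K * G' * E) * G₀ := by rw [h]
      _ = (K' * K) * G' * E * G₀ := by simp only [Matrix.mul_assoc]
      _ = G' * E * G₀ := by rw [hk', Matrix.one_mul]

lemma mem_H₁_iff (g : G) : g ∈ H₁ ↔
    (g : Matrix (Fin 3) (Fin 3) ℝ) * Matrix.single 2 2 1 =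
      Matrix.single 2 2 1 * (g : Matrix (Fin 3) (Fin 3) ℝ) := by
  have : g ∈ H₁ ↔ g 0 2 = 0 ∧ g 1 2 = 0 ∧ g 2 0 = 0 ∧ g 2 1 = 0 := Iff.rfl
  rw [this, ← Matrix.ext_iff]
  simp [Fin.forall_fin_succ, Matrix.mul_apply, Fin.sum_univ_three, Matrix.single_apply, eq_comm]

lemma mem_H₂_iff (g : G) : g ∈ H₂ ↔
    (g : Matrix (Fin 3) (Fin 3) ℝ) * Matrix.single 1 1 1 =
      Matrix.single 1 1 1 * (g : Matrix (Fin 3) (Fin 3) ℝ) := by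
  have : g ∈ H₂ ↔ g 0 1 = 0 ∧ g 1 0 = 0 ∧ g 1 2 = 0 ∧ g 2 1 = 0 := Iff.rfl
  rw [this, ← Matrix.ext_iff]
  simp [Fin.forall_fin_succ, Matrix.mul_apply, Fin.sum_univ_three, Matrix.single_apply, eq_comm]
  tauto

lemma A_le_H₁ : A ≤ H₁ := by
  rintro g ⟨t, -, hg⟩
  show g 0 2 = 0 ∧ g 1 2 = 0 ∧ g 2 0 = 0 ∧ g 2 1 = 0
  simp [hg]

lemma A_le_H₂ : A ≤ H₂ := by
  rintro g ⟨t, -, hg⟩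
  show g 0 1 = 0 ∧ g 1 0 = 0 ∧ g 1 2 = 0 ∧ g 2 1 = 0
  simp [hg]

lemma smul_eGam (g : G) : g • eGam = ((g : G) : X3) := by
  simp [eGam]

/-- Two elements of `G` give the same point of `X₃` exactly if they differ by an element of `Γ` on
the right. -/
lemma mk_eq_mk_iff (g k : G) : (g : X3) = (k : X3) ↔ ∃ γ ∈ Gam, k = g * γ := by
  rw [QuotientGroup.eq]
  exact ⟨fun h => ⟨_, h, by group⟩, by rintro ⟨γ, h, rfl⟩; simpa using h⟩

/-! ### Closed orbits of centralizers of projections -/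

/-- The orbit through `g Γ` of the centralizer `H` of `Eᵢᵢ` consists of the `k Γ` for which
`k⁻¹ Eᵢᵢ k` is `Γ`-conjugate to `g⁻¹ Eᵢᵢ g`. -/
lemma mk_mem_orbit_iff {H : Subgroup G} {i : Fin 3}
    (hH : ∀ g : G, g ∈ H ↔ (g : Matrix (Fin 3) (Fin 3) ℝ) * Matrix.single i i 1 =
      Matrix.single i i 1 * (g : Matrix (Fin 3) (Fin 3) ℝ)) (k g : G) :
    (k : X3) ∈ MulAction.orbit H (g • eGam) ↔
      ∃ γ ∈ Gam, projConj i k = projConj i (g * γ) := by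
  rw [smul_eGam]
  constructor
  · rintro ⟨h, hh⟩
    obtain ⟨γ, hγ, e⟩ := (mk_eq_mk_iff ((h : G) * g) k).1 hh
    refine ⟨γ, hγ, (projConj_eq_iff _ _ _).2 ((hH _).1 ?_)⟩
    rw [e]
    simp only [mul_inv_rev]
    convert h.2 using 1
    group
  · rintro ⟨γ, hγ, e⟩
    rw [projConj_eq_iff, ← hH] at e
    refine ⟨⟨_, e⟩, (mk_eq_mk_iff _ _).2 ⟨γ, hγ, ?_⟩⟩
    show k = k * (g * γ)⁻¹ * g * γ
    group

/-- The real matrices that have integral entries after multiplication by `q`. -/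
def integralMul (q : ℕ) : Set (Matrix (Fin 3) (Fin 3) ℝ) :=
  {M | ∃ Z : Matrix (Fin 3) (Fin 3) ℤ, (q : ℝ) • M = Z.map (Int.castRingHom ℝ)}

lemma conj_mem_integralMul {q : ℕ} {M : Matrix (Fin 3) (Fin 3) ℝ} (hM : M ∈ integralMul q)
    {γ : G} (hγ : γ ∈ Gam) :
    ((γ⁻¹ : G) : Matrix (Fin 3) (Fin 3) ℝ) * M * (γ : Matrix (Fin 3) (Fin 3) ℝ) ∈
      integralMul q := by
  obtain ⟨Z, hZ⟩ := hM
  obtain ⟨δ, rfl⟩ := hγ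
  refine ⟨((δ⁻¹ : Matrix.SpecialLinearGroup (Fin 3) ℤ) : Matrix (Fin 3) (Fin 3) ℤ) * Z *
    (δ : Matrix (Fin 3) (Fin 3) ℤ), ?_⟩
  rw [Matrix.map_mul, Matrix.map_mul, ← hZ, ← map_inv, Matrix.SpecialLinearGroup.map_apply_coe,
    Matrix.SpecialLinearGroup.map_apply_coe, RingHom.mapMatrix_apply, RingHom.mapMatrix_apply,
    Matrix.mul_smul, Matrix.smul_mul]

lemma isClosed_of_subset_integralMul {q : ℕ} (hq : q ≠ 0) {S : Set (Matrix (Fin 3) (Fin 3) ℝ)}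
    (hS : S ⊆ integralMul q) : IsClosed S := by
  have hc : IsClosedEmbedding fun Z : Matrix (Fin 3) (Fin 3) ℤ => Z.map (Int.castRingHom ℝ) :=
    Real.isClosedEmbedding_intCast.matrix_map
  have : S = (fun M => (q : ℝ) • M) ⁻¹' ((fun Z : Matrix (Fin 3) (Fin 3) ℤ =>
      Z.map (Int.castRingHom ℝ)) '' {Z | ∃ M ∈ S, (q : ℝ) • M = Z.map (Int.castRingHom ℝ)}) := by
    ext M
    constructor
    · intro hM
      obtain ⟨Z, hZ⟩ := hS hM
      exact ⟨Z, ⟨M, hM, hZ⟩, hZ.symm⟩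
    · rintro ⟨Z, ⟨M', hM', h'⟩, hZ⟩
      have : (q : ℝ) • M' = (q : ℝ) • M := h'.trans hZ
      rwa [← smul_right_injective _ (by exact_mod_cast hq : (q : ℝ) ≠ 0) this]
  rw [this]
  exact (hc.isClosedMap _ (isClosed_discrete _)).preimage (continuous_const_smul _)

lemma continuous_projConj (i : Fin 3) : Continuous (projConj i) := by
  unfold projConj
  have h1 : Continuous fun k : G => (k : Matrix (Fin 3) (Fin 3) ℝ) := continuous_subtype_val
  have h2 : Continuous fun k : G => ((k⁻¹ : G) : Matrix (Fin 3) (Fin 3) ℝ) :=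
    h1.comp continuous_inv
  exact (h2.mul continuous_const).mul h1

/-- If `g⁻¹ Eᵢᵢ g` is rational, then the orbit through `g Γ` of the centralizer of `Eᵢᵢ` is closed:
it is the preimage of a set of matrices with bounded denominators under a continuous map. -/
lemma isClosed_orbit {H : Subgroup G} {i : Fin 3}
    (hH : ∀ g : G, g ∈ H ↔ (g : Matrix (Fin 3) (Fin 3) ℝ) * Matrix.single i i 1 =
      Matrix.single i i 1 * (g : Matrix (Fin 3) (Fin 3) ℝ)) {q : ℕ} (hq : q ≠ 0) {g : G}
    (hg : projConj i g ∈ integralMul q) : IsClosed (MulAction.orbit H (g • eGam)) := by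
  rw [← (QuotientGroup.isOpenQuotientMap_mk (N := Gam)).isQuotientMap.isClosed_preimage]
  have : ((↑) : G → X3) ⁻¹' (MulAction.orbit H (g • eGam)) =
      projConj i ⁻¹' {M | ∃ γ ∈ Gam, M = projConj i (g * γ)} := by
    ext k
    exact mk_mem_orbit_iff hH k g
  rw [this]
  refine (isClosed_of_subset_integralMul hq ?_).preimage (continuous_projConj i)
  rintro M ⟨γ, hγ, rfl⟩
  rw [projConj_mul]
  exact conj_mem_integralMul hg hγ

lemma projConj_mem_integralMul_of_mem_orbit {H : Subgroup G} {i : Fin 3}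
    (hH : ∀ g : G, g ∈ H ↔ (g : Matrix (Fin 3) (Fin 3) ℝ) * Matrix.single i i 1 =
      Matrix.single i i 1 * (g : Matrix (Fin 3) (Fin 3) ℝ)) {q : ℕ} {g : G}
    (hg : projConj i g ∈ integralMul q) {k : G}
    (hk : (k : X3) ∈ MulAction.orbit H (g • eGam)) : projConj i k ∈ integralMul q := by
  obtain ⟨γ, hγ, e⟩ := (mk_mem_orbit_iff hH k g).1 hk
  rw [e, projConj_mul]
  exact conj_mem_integralMul hg hγ

lemma hMat_inv (a b : ℝ) : (hMat a b)⁻¹ = hMat (-a) (-b) := by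
  rw [inv_eq_iff_mul_eq_one]
  ext i j
  rw [Matrix.SpecialLinearGroup.coe_mul, Matrix.mul_apply, Fin.sum_univ_three]
  fin_cases i <;> fin_cases j <;> simp [hMat]

lemma projConj_hMat_mem₁ {q : ℕ} (hq : q ≠ 0) :
    projConj 2 (hMat 0 (q : ℝ)⁻¹) ∈ integralMul q := by
  refine ⟨!![0, 0, 0; 0, 0, 0; 1, 0, q], ?_⟩
  ext r c
  rw [Matrix.smul_apply, projConj_apply, hMat_inv]
  have : (q : ℝ) ≠ 0 := by exact_mod_cast hq
  fin_cases r <;> fin_cases c <;> simp [hMat, this]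

lemma projConj_hMat_mem₂ {q : ℕ} (hq : q ≠ 0) :
    projConj 1 (hMat (q : ℝ)⁻¹ 0) ∈ integralMul q := by
  refine ⟨!![0, 0, 0; 1, q, 0; 0, 0, 0], ?_⟩
  ext r c
  rw [Matrix.smul_apply, projConj_apply, hMat_inv]
  have : (q : ℝ) ≠ 0 := by exact_mod_cast hq
  fin_cases r <;> fin_cases c <;> simp [hMat, this]

lemma isClosed_M₁ {q : ℕ} (hq : q ≠ 0) : IsClosed (M₁ q) :=
  isClosed_orbit mem_H₁_iff hq (projConj_hMat_mem₁ hq)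

lemma isClosed_M₂ {q : ℕ} (hq : q ≠ 0) : IsClosed (M₂ q) :=
  isClosed_orbit mem_H₂_iff hq (projConj_hMat_mem₂ hq)

lemma not_irrational_of_mem_integralMul {q : ℕ} (hq : q ≠ 0) {M : Matrix (Fin 3) (Fin 3) ℝ}
    (hM : M ∈ integralMul q) (r c : Fin 3) : ¬ Irrational (M r c) := by
  obtain ⟨Z, hZ⟩ := hM
  have h := congrFun (congrFun hZ r) c
  simp only [Matrix.smul_apply, smul_eq_mul, Matrix.map_apply, Int.coe_castRingHom] at h
  have hq' : (q : ℝ) ≠ 0 := by exact_mod_cast hq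
  rw [Irrational, not_not]
  refine ⟨(Z r c : ℚ) / q, ?_⟩
  push_cast
  rw [← h]
  field_simp

/-- For irrational `α` and `β` none of the projections `h_v⁻¹ Eᵢᵢ h_v` is rational. -/
lemma projConj_hMat_notMem {α β : ℝ} (hα : Irrational α) (hβ : Irrational β) {q : ℕ} (hq : q ≠ 0)
    (i : Fin 3) : projConj i (hMat α β) ∉ integralMul q := by
  intro h
  have key := not_irrational_of_mem_integralMul hq h
  fin_cases i
  · refine key 1 0 ?_
    rw [projConj_apply, hMat_inv]
    simpa [hMat] using hα
  · refine key 1 0 ?_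
    rw [projConj_apply, hMat_inv]
    simpa [hMat] using hα
  · refine key 2 0 ?_
    rw [projConj_apply, hMat_inv]
    simpa [hMat] using hβ

/-- If `g⁻¹ E₃₃ g` is a coordinate projection, then `g x_v` is not in `M⁽¹⁾_q`. -/
lemma smul_xPt_notMem_M₁ {α β : ℝ} (hα : Irrational α) (hβ : Irrational β) {q : ℕ} (hq : q ≠ 0)
    {g : G} {j : Fin 3} (hg : projConj 2 g = projConj j 1) : g • xPt α β ∉ M₁ q := by
  intro h
  rw [xPt, smul_smul, smul_eGam] at h
  have := projConj_mem_integralMul_of_mem_orbit mem_H₁_iff (projConj_hMat_mem₁ hq) h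
  rw [projConj_mul, hg, ← projConj_mul, one_mul] at this
  exact projConj_hMat_notMem hα hβ hq j this

lemma smul_xPt_notMem_M₂ {α β : ℝ} (hα : Irrational α) (hβ : Irrational β) {q : ℕ} (hq : q ≠ 0)
    {g : G} {j : Fin 3} (hg : projConj 1 g = projConj j 1) : g • xPt α β ∉ M₂ q := by
  intro h
  rw [xPt, smul_smul, smul_eGam] at h
  have := projConj_mem_integralMul_of_mem_orbit mem_H₂_iff (projConj_hMat_mem₂ hq) h
  rw [projConj_mul, hg, ← projConj_mul, one_mul] at this
  exact projConj_hMat_notMem hα hβ hq j this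

lemma projConj_of_mem_A (i : Fin 3) {a : G} (ha : a ∈ A) : projConj i a = projConj i 1 := by
  rw [projConj_eq_iff, inv_one, mul_one]
  obtain ⟨t, -, ht⟩ := ha
  rw [ht]
  ext r c
  simp only [Matrix.diagonal_mul, Matrix.mul_diagonal, Matrix.single_apply]
  split_ifs with h
  · rw [← h.1, ← h.2]; ring
  · simp

lemma disjoint_orbit_xPt {α β : ℝ} (hα : Irrational α) (hβ : Irrational β) {q q' : ℕ}
    (hq : q ≠ 0) (hq' : q' ≠ 0) :
    Disjoint (MulAction.orbit A (xPt α β)) (M₁ q ∪ M₂ q') := by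
  rw [Set.disjoint_left]
  rintro _ ⟨a, rfl⟩ (h | h)
  · exact smul_xPt_notMem_M₁ hα hβ hq (projConj_of_mem_A 2 a.2) h
  · exact smul_xPt_notMem_M₂ hα hβ hq' (projConj_of_mem_A 1 a.2) h

/-! ### Lattices near a given one have no short vectors -/

/-- Around each point of `X₃` there is a neighbourhood of lattices whose nonzero vectors are bounded
away from zero. -/
lemma exists_forall_le_abs_mulVec (x : X3) : ∃ ε > 0, ∀ᶠ z in 𝓝 x, ∀ g : G, (g : X3) = z →
    ∀ w : Fin 3 → ℤ, w ≠ 0 →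
      ∃ i, ε ≤ |((g : Matrix (Fin 3) (Fin 3) ℝ).mulVec fun j => (w j : ℝ)) i| := by
  obtain ⟨g₀, rfl⟩ := QuotientGroup.mk_surjective x
  set K : ℝ := 1 + ∑ i, ∑ j, |(g₀⁻¹ : G) i j| with hK
  have hK0 : 0 < K := by positivity
  set V : Set G := {k | ∀ i j, |(k⁻¹ : G) i j| < K} with hV
  have hVo : IsOpen V := by
    have : V = ⋂ i, ⋂ j, {k : G | |(k⁻¹ : G) i j| < K} := by ext; simp [hV]
    rw [this]
    refine isOpen_iInter_of_finite fun i => isOpen_iInter_of_finite fun j => ?_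
    refine isOpen_lt (continuous_abs.comp ?_) continuous_const
    have h1 : Continuous fun k : G => ((k⁻¹ : G) : Matrix (Fin 3) (Fin 3) ℝ) :=
      continuous_subtype_val.comp continuous_inv
    exact h1.matrix_elem i j
  have hg₀ : g₀ ∈ V := by
    intro i j
    have h1 : |(g₀⁻¹ : G) i j| ≤ ∑ j, |(g₀⁻¹ : G) i j| :=
      Finset.single_le_sum (f := fun j => |(g₀⁻¹ : G) i j|) (fun _ _ => abs_nonneg _)
        (Finset.mem_univ j)
    have h2 : ∑ j, |(g₀⁻¹ : G) i j| ≤ ∑ i, ∑ j, |(g₀⁻¹ : G) i j| :=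
      Finset.single_le_sum (f := fun i => ∑ j, |(g₀⁻¹ : G) i j|)
        (fun _ _ => Finset.sum_nonneg fun _ _ => abs_nonneg _) (Finset.mem_univ i)
    linarith
  -- A vector with coordinates below `1 / (3 K)` is mapped by `k⁻¹`, for `k ∈ V`, to a vector with
  -- coordinates below `1`, which is zero if it is integral.
  refine ⟨1 / (3 * K), by positivity, ?_⟩
  have hn := QuotientGroup.isOpenQuotientMap_mk.isOpenMap.image_mem_nhds (hVo.mem_nhds hg₀)
    (f := ((↑) : G → X3))
  filter_upwards [hn]
  rintro _ ⟨k, hk, rfl⟩ g hg w hw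
  obtain ⟨γ, ⟨δ, rfl⟩, rfl⟩ := (mk_eq_mk_iff k g).1 hg.symm
  by_contra! hcon
  set w' : Fin 3 → ℤ := (δ : Matrix (Fin 3) (Fin 3) ℤ).mulVec w with hw'
  have hcast : ((Matrix.SpecialLinearGroup.map (Int.castRingHom ℝ) δ : G) :
      Matrix (Fin 3) (Fin 3) ℝ).mulVec (fun j => (w j : ℝ)) = fun j => (w' j : ℝ) := by
    ext i
    simp [hw', Matrix.mulVec, dotProduct]
  rw [Matrix.SpecialLinearGroup.coe_mul, ← Matrix.mulVec_mulVec, hcast] at hcon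
  have hw0 : w' = 0 := by
    ext i
    have e : (w' i : ℝ) = ((k⁻¹ : G) : Matrix (Fin 3) (Fin 3) ℝ).mulVec
        ((k : Matrix (Fin 3) (Fin 3) ℝ).mulVec fun j => (w' j : ℝ)) i := by
      rw [Matrix.mulVec_mulVec, coe_inv_mul_coe, Matrix.one_mulVec]
    have hlt : |(w' i : ℝ)| < 1 := by
      rw [e, Matrix.mulVec, dotProduct]
      calc _ ≤ ∑ j, |(k⁻¹ : G) i j *
              (k : Matrix (Fin 3) (Fin 3) ℝ).mulVec (fun j => (w' j : ℝ)) j| :=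
            Finset.abs_sum_le_sum_abs _ _
        _ < ∑ _j : Fin 3, K * (1 / (3 * K)) := by
            refine Finset.sum_lt_sum_of_nonempty Finset.univ_nonempty fun j _ => ?_
            rw [abs_mul]
            exact mul_lt_mul'' (hk i j) (hcon j) (abs_nonneg _) (abs_nonneg _)
        _ = 1 := by
            simp
            field_simp
    rw [← Int.cast_abs] at hlt
    have : |w' i| < 1 := by exact_mod_cast hlt
    simpa using Int.abs_lt_one_iff.1 this
  apply hw
  have : ((δ⁻¹ : Matrix.SpecialLinearGroup (Fin 3) ℤ) : Matrix (Fin 3) (Fin 3) ℤ).mulVec w' =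
      w := by
    rw [hw', Matrix.mulVec_mulVec, ← Matrix.SpecialLinearGroup.coe_mul, inv_mul_cancel,
      Matrix.SpecialLinearGroup.coe_one, Matrix.one_mulVec]
  rw [← this, hw0, Matrix.mulVec_zero]

/-! ### Short vectors away from the two rays -/

/-- If `diag(exp s) h_v ℤ³` has no short vectors, then both `s 1` and `s 2` are bounded below, and
one of them is bounded above. The upper bound comes from the vectors of `h_v ℤ³` in the plane
`z = (p₁ / q) y`, in which Dirichlet's theorem provides a short one. -/
lemma exists_bound_of_no_short_vector {α β : ℝ} {q : ℕ} {p₁ p₂ : ℤ} (hq : 0 < q)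
    (hβ : β = (p₁ : ℝ) / q * α + (p₂ : ℝ) / q) {ε : ℝ} (hε : 0 < ε) :
    ∃ C, 0 ≤ C ∧ ∀ s : Fin 3 → ℝ, ∑ i, s i = 0 →
      (∀ w : Fin 3 → ℤ, w ≠ 0 → ∃ i, ε ≤ Real.exp (s i) *
        |((hMat α β : G) : Matrix (Fin 3) (Fin 3) ℝ).mulVec (fun j => (w j : ℝ)) i|) →
      (|s 2| ≤ C ∧ -C ≤ s 1) ∨ (|s 1| ≤ C ∧ -C ≤ s 2) := by
  have hq0 : (0 : ℝ) < q := by exact_mod_cast hq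
  set D : ℝ := (q + |(p₁ : ℝ)|) / ε with hD
  have hD0 : 0 < D := by positivity
  refine ⟨|Real.log ε| + 2 * |Real.log D|, by positivity, fun s hs hw => ?_⟩
  set C := |Real.log ε| + 2 * |Real.log D| with hC
  have hmv : ∀ w : Fin 3 → ℝ, ((hMat α β : G) : Matrix (Fin 3) (Fin 3) ℝ).mulVec w =
      ![w 0, α * w 0 + w 1, β * w 0 + w 2] := by
    intro w
    ext i
    fin_cases i <;> simp [hMat, Matrix.mulVec, dotProduct, Fin.sum_univ_three]
  rw [Fin.sum_univ_three] at hs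
  have hlog : -Real.log ε ≤ C := by
    have := neg_abs_le (Real.log ε)
    have := abs_nonneg (Real.log D)
    linarith
  have h1 : -C ≤ s 1 := by
    obtain ⟨i, hi⟩ := hw ![0, 1, 0] (by simp)
    rw [hmv] at hi
    have hi' : ε ≤ Real.exp (s 1) := by fin_cases i <;> simp at hi <;> linarith
    have := (Real.log_le_iff_le_exp hε).2 hi'
    linarith
  have h2 : -C ≤ s 2 := by
    obtain ⟨i, hi⟩ := hw ![0, 0, 1] (by simp)
    rw [hmv] at hi
    have hi' : ε ≤ Real.exp (s 2) := by fin_cases i <;> simp at hi <;> linarith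
    have := (Real.log_le_iff_le_exp hε).2 hi'
    linarith
  have hmin : min (s 1) (s 2) ≤ C := by
    set μ := min (s 1) (s 2) with hμ
    set M := max (s 1) (s 2) with hM
    have hsum : μ + M = s 1 + s 2 := min_add_max _ _
    have hμM : μ ≤ M := min_le_max
    rcases le_or_gt μ 0 with hμ0 | hμ0
    · exact hμ0.trans (by positivity)
    -- The denominator `k ≤ n` balances the contraction `e^(-μ-M)` of the first coordinate against
    -- the expansion, by at most `e^M`, of the other two.
    set n := ⌊Real.exp (M + μ / 2)⌋₊ with hn
    have hn0 : 0 < n := Nat.floor_pos.2 (Real.one_le_exp (by linarith))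
    obtain ⟨j, k, hk0, hkn, hjk⟩ := Real.exists_int_int_abs_mul_sub_le α hn0
    have hy : |k * α - j| ≤ Real.exp (-(M + μ / 2)) := by
      refine hjk.trans ?_
      rw [Real.exp_neg, one_div]
      exact inv_anti₀ (Real.exp_pos _) (Nat.lt_floor_add_one _).le
    have hkR : (0 : ℝ) < k := by exact_mod_cast hk0
    have hk : (k : ℝ) ≤ Real.exp (M + μ / 2) := by
      have : (k : ℝ) ≤ n := by exact_mod_cast hkn
      exact this.trans (Nat.floor_le (Real.exp_pos _).le)
    -- The vector of `x_v` with these integral coordinates is `(q k, q (k α - j), p₁ (k α - j))`.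
    have hw0 : (![(q : ℤ) * k, -(q * j), -(p₁ * j) - p₂ * k] : Fin 3 → ℤ) ≠ 0 := by
      intro h
      have := congrFun h 0
      simp at this
      omega
    obtain ⟨i, hi⟩ := hw _ hw0
    rw [hmv] at hi
    have hp : 0 ≤ |(p₁ : ℝ)| := abs_nonneg _
    have hx : ∀ u ≤ M, Real.exp u * |k * α - j| ≤ Real.exp (-(μ / 2)) := by
      intro u hu
      calc Real.exp u * |k * α - j| ≤ Real.exp M * Real.exp (-(M + μ / 2)) := by gcongr
        _ = Real.exp (-(μ / 2)) := by rw [← Real.exp_add]; ring_nf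
    have key : ε ≤ (q + |(p₁ : ℝ)|) * Real.exp (-(μ / 2)) := by
      have e0 := Real.exp_pos (-(μ / 2))
      fin_cases i
      · simp only [Fin.zero_eta, Matrix.cons_val_zero, Int.cast_mul, Int.cast_natCast] at hi
        rw [abs_of_pos (by positivity)] at hi
        calc ε ≤ q * (Real.exp (s 0) * k) := by linarith
          _ ≤ q * (Real.exp (s 0) * Real.exp (M + μ / 2)) := by gcongr
          _ = q * Real.exp (-(μ / 2)) := by
              rw [← Real.exp_add]
              congr 2
              linarith
          _ ≤ _ := by nlinarith
      · have e : α * (q * k) + -(q * j) = q * (k * α - j) := by ring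
        simp at hi
        rw [e, abs_mul, abs_of_pos hq0] at hi
        have := hx (s 1) (le_max_left _ _)
        nlinarith
      · have e : β * (q * k) + (-(p₁ * j) - p₂ * k) = p₁ * (k * α - j) := by
          rw [hβ]
          field_simp
          ring
        simp at hi
        rw [e, abs_mul] at hi
        have := hx (s 2) (le_max_right _ _)
        nlinarith
    have hμD : Real.exp (μ / 2) ≤ D := by
      rw [hD, le_div_iff₀ hε]
      calc Real.exp (μ / 2) * ε ≤ Real.exp (μ / 2) * ((q + |(p₁ : ℝ)|) * Real.exp (-(μ / 2))) := by
            gcongr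
        _ = (q + |(p₁ : ℝ)|) * (Real.exp (μ / 2) * Real.exp (-(μ / 2))) := by ring
        _ = _ := by rw [← Real.exp_add]; simp
    have := (Real.le_log_iff_exp_le hD0).2 hμD
    have := le_abs_self (Real.log D)
    have := abs_nonneg (Real.log ε)
    linarith
  rcases min_le_iff.1 hmin with h | h
  · exact Or.inr ⟨abs_le.2 ⟨h1, h⟩, h2⟩
  · exact Or.inl ⟨abs_le.2 ⟨h2, h⟩, h1⟩

/-! ### Closeness to the two rays -/

/-- The elements of `A` whose logarithmic coordinates are bounded by `C`. -/
def boxA (C : ℝ) : Set G :=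
  {b | ∃ s : Fin 3 → ℝ, ∑ i, s i = 0 ∧ (∀ i, |s i| ≤ C) ∧
    (b : Matrix (Fin 3) (Fin 3) ℝ) = Matrix.diagonal fun i => Real.exp (s i)}

lemma boxA_subset (C : ℝ) : boxA C ⊆ A := by
  rintro b ⟨s, hs, -, hb⟩
  exact ⟨s, hs, hb⟩

lemma isCompact_boxA (C : ℝ) : IsCompact (boxA C) := by
  have hK : IsCompact (((univ : Set (Fin 3)).pi fun _ => Icc (-C) C) ∩
      {s : Fin 3 → ℝ | ∑ i, s i = 0}) :=
    (isCompact_univ_pi fun _ => isCompact_Icc).inter_right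
      (isClosed_eq (by fun_prop) continuous_const)
  have hc : Continuous fun s : Fin 3 → ℝ => Matrix.diagonal fun i => Real.exp (s i) := by
    refine Continuous.matrix_diagonal ?_
    fun_prop
  have := Matrix.SpecialLinearGroup.isClosedEmbedding_val (n := Fin 3) (R := ℝ)
    |>.isCompact_preimage (hK.image hc)
  refine (Set.Subset.antisymm ?_ ?_ : _ = boxA C) ▸ this
  · rintro b ⟨s, ⟨hC, hs⟩, hb⟩
    exact ⟨s, hs, fun i => abs_le.2 (hC i trivial), hb.symm⟩
  · rintro b ⟨s, hs, hC, hb⟩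
    exact ⟨s, ⟨fun i _ => abs_le.1 (hC i), hs⟩, hb.symm⟩

lemma logCoord_eq {a : G} {s : Fin 3 → ℝ}
    (ha : (a : Matrix (Fin 3) (Fin 3) ℝ) = Matrix.diagonal fun i => Real.exp (s i)) :
    logCoord a = WithLp.toLp 2 s := by
  simp [logCoord, ha]

lemma coe_a₁ (t : ℝ) : ((a₁ t : G) : Matrix (Fin 3) (Fin 3) ℝ) =
    Matrix.diagonal fun i => Real.exp (![-t, t, 0] i) := by
  ext i j
  fin_cases i <;> fin_cases j <;> simp [a₁]

lemma coe_a₂ (t : ℝ) : ((a₂ t : G) : Matrix (Fin 3) (Fin 3) ℝ) =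
    Matrix.diagonal fun i => Real.exp (![-t, 0, t] i) := by
  ext i j
  fin_cases i <;> fin_cases j <;> simp [a₂]

lemma a₁_mem_A (t : ℝ) : a₁ t ∈ A := ⟨_, by simp [Fin.sum_univ_three], coe_a₁ t⟩

lemma a₂_mem_A (t : ℝ) : a₂ t ∈ A := ⟨_, by simp [Fin.sum_univ_three], coe_a₂ t⟩

lemma distA_rays_le {a b c : G} {C : ℝ} (hb : b ∈ boxA C) (hc : c ∈ rays) (ha : a = b * c) :
    distA a rays ≤ 2 * C := by
  have hcA : c ∈ A := by
    rcases hc with ⟨t, -, rfl⟩ | ⟨t, -, rfl⟩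
    exacts [a₁_mem_A t, a₂_mem_A t]
  refine (Metric.infDist_le_dist_of_mem (mem_image_of_mem _ hc)).trans ?_
  obtain ⟨u, -, hu⟩ := hcA
  obtain ⟨s, -, hsC, hs⟩ := hb
  have hau : (a : Matrix (Fin 3) (Fin 3) ℝ) = Matrix.diagonal fun i => Real.exp ((s + u) i) := by
    rw [ha, Matrix.SpecialLinearGroup.coe_mul, hs, hu, Matrix.diagonal_mul_diagonal]
    simp [Real.exp_add]
  have hC : 0 ≤ C := (abs_nonneg _).trans (hsC 0)
  rw [logCoord_eq hau, logCoord_eq hu, EuclideanSpace.dist_eq]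
  refine Real.sqrt_le_iff.2 ⟨by positivity, ?_⟩
  have h : ∀ i, s i ^ 2 ≤ C ^ 2 := fun i => sq_le_sq' (abs_le.1 (hsC i)).1 (abs_le.1 (hsC i)).2
  have h0 := h 0
  have h1 := h 1
  have h2 := h 2
  simp [Fin.sum_univ_three]
  nlinarith

/-- If `a x_v` stays near a fixed point of `X₃`, then `a` is at bounded distance from one of the two
rays. -/
lemma exists_mem_boxA_mul {α β : ℝ} {q : ℕ} {p₁ p₂ : ℤ} (hq : 0 < q)
    (hβ : β = (p₁ : ℝ) / q * α + (p₂ : ℝ) / q) (x : X3) :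
    ∃ C, ∀ᶠ z in 𝓝 x, ∀ a ∈ A, a • xPt α β = z →
      ∃ b ∈ boxA C, ∃ t : ℝ, 0 < t ∧ (a = b * a₁ t ∨ a = b * a₂ t) := by
  obtain ⟨ε, hε, hx⟩ := exists_forall_le_abs_mulVec x
  obtain ⟨C, hC0, hC⟩ := exists_bound_of_no_short_vector hq hβ hε
  refine ⟨2 * C + 1, hx.mono fun z hz a ha haz => ?_⟩
  obtain ⟨s, hs, has⟩ := ha
  have hs' := hs
  rw [Fin.sum_univ_three] at hs'
  have hab := hC s hs fun w hw => by
    obtain ⟨i, hi⟩ := hz (a * hMat α β) (by rw [← haz, xPt, smul_smul, smul_eGam]) w hw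
    refine ⟨i, ?_⟩
    rwa [Matrix.SpecialLinearGroup.coe_mul, ← Matrix.mulVec_mulVec, has, Matrix.mulVec_diagonal,
      abs_mul, abs_of_pos (Real.exp_pos _)] at hi
  rcases hab with ⟨h2, h1⟩ | ⟨h1, h2⟩
  · set t := max (s 1) 1
    have ht : 0 < t := lt_max_of_lt_right one_pos
    have hle : s 1 ≤ t := le_max_left _ _
    have hle' : t ≤ s 1 + (C + 1) := max_le (by linarith) (by linarith)
    have hm : ∀ t : ℝ, a = (a * (a₁ t)⁻¹) * a₁ t := fun t => by group
    refine ⟨a * (a₁ t)⁻¹, ⟨![s 0 + t, s 1 - t, s 2], ?_, ?_, ?_⟩, t, ht, Or.inl (hm t)⟩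
    · simp [Fin.sum_univ_three]; linarith
    · rw [abs_le] at h2
      intro i
      fin_cases i <;> simp [abs_le] <;> constructor <;> linarith
    · have e : ((a₁ t)⁻¹ : G) = a₁ (-t) := by
        rw [inv_eq_iff_mul_eq_one]
        ext i j
        rw [Matrix.SpecialLinearGroup.coe_mul, coe_a₁, coe_a₁, Matrix.diagonal_mul_diagonal]
        fin_cases i <;> fin_cases j <;> simp [← Real.exp_add]
      rw [Matrix.SpecialLinearGroup.coe_mul, e, has, coe_a₁, Matrix.diagonal_mul_diagonal]
      congr 1
      ext i
      fin_cases i <;> simp [← Real.exp_add, sub_eq_add_neg]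
  · set t := max (s 2) 1
    have ht : 0 < t := lt_max_of_lt_right one_pos
    have hle : s 2 ≤ t := le_max_left _ _
    have hle' : t ≤ s 2 + (C + 1) := max_le (by linarith) (by linarith)
    have hm : ∀ t : ℝ, a = (a * (a₂ t)⁻¹) * a₂ t := fun t => by group
    refine ⟨a * (a₂ t)⁻¹, ⟨![s 0 + t, s 1, s 2 - t], ?_, ?_, ?_⟩, t, ht, Or.inr (hm t)⟩
    · simp [Fin.sum_univ_three]; linarith
    · rw [abs_le] at h1
      intro i
      fin_cases i <;> simp [abs_le] <;> constructor <;> linarith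
    · have e : ((a₂ t)⁻¹ : G) = a₂ (-t) := by
        rw [inv_eq_iff_mul_eq_one]
        ext i j
        rw [Matrix.SpecialLinearGroup.coe_mul, coe_a₂, coe_a₂, Matrix.diagonal_mul_diagonal]
        fin_cases i <;> fin_cases j <;> simp [← Real.exp_add]
      rw [Matrix.SpecialLinearGroup.coe_mul, e, has, coe_a₂, Matrix.diagonal_mul_diagonal]
      congr 1
      ext i
      fin_cases i <;> simp [← Real.exp_add, sub_eq_add_neg]

lemma not_tendsto_of_distA {α β : ℝ} {q : ℕ} {p₁ p₂ : ℤ} (hq : 0 < q)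
    (hβ : β = (p₁ : ℝ) / q * α + (p₂ : ℝ) / q) {a : ℕ → G} (ha : ∀ n, a n ∈ A)
    (hd : Tendsto (fun n => distA (a n) rays) atTop atTop) {φ : ℕ → ℕ} (hφ : StrictMono φ)
    (x : X3) : ¬ Tendsto (fun n => a (φ n) • xPt α β) atTop (𝓝 x) := by
  intro hx
  obtain ⟨C, hC⟩ := exists_mem_boxA_mul hq hβ x
  obtain ⟨n, hn, hn'⟩ := ((hx.eventually hC).and
    ((hd.comp hφ.tendsto_atTop).eventually_gt_atTop (2 * C))).exists
  obtain ⟨b, hb, t, ht, h⟩ := hn _ (ha _) rfl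
  refine hn'.not_ge ?_
  rcases h with h | h
  · exact distA_rays_le hb (Or.inl ⟨t, ht, rfl⟩) h
  · exact distA_rays_le hb (Or.inr ⟨t, ht, rfl⟩) h

/-! ### Reduced forms -/

lemma closure_eq_top_iff {q : ℕ} {p₁ p₂ : ℤ} :
    AddSubgroup.closure {(p₁ : ZMod q), (p₂ : ZMod q)} = ⊤ ↔
      ∃ x y z : ℤ, x * p₁ + y * p₂ + z * q = 1 := by
  have key : (1 : ZMod q) ∈ AddSubgroup.closure {(p₁ : ZMod q), (p₂ : ZMod q)} ↔
      ∃ x y z : ℤ, x * p₁ + y * p₂ + z * q = 1 := by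
    rw [AddSubgroup.mem_closure_pair]
    constructor
    · rintro ⟨x, y, h⟩
      have : ((x * p₁ + y * p₂ : ℤ) : ZMod q) = ((1 : ℤ) : ZMod q) := by
        push_cast
        rw [← h]
        simp
      rw [ZMod.intCast_eq_intCast_iff_dvd_sub] at this
      obtain ⟨z, hz⟩ := this
      exact ⟨x, y, z, by linarith⟩
    · rintro ⟨x, y, z, h⟩
      refine ⟨x, y, ?_⟩
      have := congrArg (Int.cast : ℤ → ZMod q) h
      push_cast at this
      simpa using this
  rw [← key]
  constructor
  · intro h
    rw [h]
    trivial
  · intro h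
    rw [eq_top_iff]
    intro a _
    obtain ⟨n, rfl⟩ := ZMod.intCast_surjective a
    simpa using AddSubgroup.zsmul_mem _ h n

/-- A rational relation between `1`, `α`, `β` yields a reduced form. -/
lemma exists_isReducedForm {α β : ℝ} (hα : Irrational α)
    (hdep : ¬ LinearIndependent ℚ ![(1 : ℝ), α, β]) :
    ∃ (q : ℕ) (p₁ p₂ : ℤ), IsReducedForm β α q p₁ p₂ := by
  rw [Fintype.not_linearIndependent_iff] at hdep
  obtain ⟨c, hc, i, hi⟩ := hdep
  simp only [Fin.sum_univ_three, Rat.smul_def] at hc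
  simp at hc
  have hc2 : c 2 ≠ 0 := by
    intro h2
    by_cases h1 : c 1 = 0
    · simp [h1, h2] at hc
      fin_cases i <;> simp_all
    · apply hα
      refine ⟨-c 0 / c 1, ?_⟩
      have h1' : (c 1 : ℝ) ≠ 0 := by exact_mod_cast h1
      push_cast
      rw [div_eq_iff h1']
      rw [h2] at hc
      simp at hc
      linarith
  obtain ⟨r₁, r₂, hr⟩ : ∃ r₁ r₂ : ℚ, β = r₁ * α + r₂ := by
    refine ⟨-c 1 / c 2, -c 0 / c 2, ?_⟩
    have h2' : (c 2 : ℝ) ≠ 0 := by exact_mod_cast hc2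
    push_cast
    field_simp
    linarith
  obtain ⟨Q, P₁, P₂, hQ, hP⟩ : ∃ Q P₁ P₂ : ℤ, 0 < Q ∧ (Q : ℝ) * β = P₁ * α + P₂ := by
    refine ⟨r₁.den * r₂.den, r₁.num * r₂.den, r₂.num * r₁.den, by positivity, ?_⟩
    have e1 : (r₁ : ℝ) * r₁.den = r₁.num := by exact_mod_cast Rat.mul_den_eq_num r₁
    have e2 : (r₂ : ℝ) * r₂.den = r₂.num := by exact_mod_cast Rat.mul_den_eq_num r₂
    push_cast
    rw [← e1, ← e2, hr]
    ring
  set d : ℤ := gcd (gcd P₁ P₂) Q with hd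
  have hd0 : d ≠ 0 := by
    intro h
    rw [hd, gcd_eq_zero_iff] at h
    omega
  have hdnn : 0 ≤ d := Int.natCast_nonneg _
  have hdpos : 0 < d := lt_of_le_of_ne hdnn hd0.symm
  obtain ⟨x, y, hxy⟩ : ∃ x y : ℤ, gcd P₁ P₂ = P₁ * x + P₂ * y :=
    ⟨_, _, Int.gcd_eq_gcd_ab P₁ P₂⟩
  obtain ⟨u, v, huv⟩ : ∃ u v : ℤ, d = gcd P₁ P₂ * u + Q * v := ⟨_, _, Int.gcd_eq_gcd_ab _ Q⟩
  obtain ⟨q, hq⟩ : d ∣ Q := gcd_dvd_right _ _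
  obtain ⟨p₁, hp₁⟩ : d ∣ P₁ := (gcd_dvd_left _ _).trans (gcd_dvd_left _ _)
  obtain ⟨p₂, hp₂⟩ : d ∣ P₂ := (gcd_dvd_left _ _).trans (gcd_dvd_right _ _)
  have hq0 : 0 < q := by
    rw [hq] at hQ
    exact (mul_pos_iff_of_pos_left hdpos).1 hQ
  lift q to ℕ using hq0.le
  have hq0' : 0 < q := by exact_mod_cast hq0
  have hqR : (q : ℝ) ≠ 0 := by exact_mod_cast hq0'.ne'
  refine ⟨q, p₁, p₂, hq0', ?_, closure_eq_top_iff.2 ⟨x * u, y * u, v, ?_⟩⟩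
  · have hdR : (d : ℝ) ≠ 0 := by exact_mod_cast hd0
    rw [hq, hp₁, hp₂] at hP
    push_cast at hP
    have : (q : ℝ) * β = p₁ * α + p₂ := by
      apply mul_left_cancel₀ hdR
      linarith
    field_simp
    linarith
  · apply mul_left_cancel₀ hd0
    rw [hxy] at huv
    calc d * (x * u * p₁ + y * u * p₂ + v * q)
        = (d * p₁ * x + d * p₂ * y) * u + d * q * v := by ring
      _ = d * 1 := by rw [← hp₁, ← hp₂, ← hq, ← huv, mul_one]

/-! ### Limit points along the first ray -/

/-- The block matrix `(a b 0; c d 0; e f 1)` of determinant one, as an element of `SL₃`. -/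
def blockSL {R : Type*} [CommRing R] (a b c d e f : R) (h : a * d - b * c = 1) :
    Matrix.SpecialLinearGroup (Fin 3) R :=
  ⟨!![a, b, 0; c, d, 0; e, f, 1], by rw [Matrix.det_fin_three]; simp; linear_combination h⟩

lemma map_blockSL {a b c d e f : ℤ} (h : a * d - b * c = 1) :
    Matrix.SpecialLinearGroup.map (Int.castRingHom ℝ) (blockSL a b c d e f h) =
      blockSL (a : ℝ) b c d e f (by exact_mod_cast h) := by
  ext i j
  rw [Matrix.SpecialLinearGroup.map_apply_coe, RingHom.mapMatrix_apply, Matrix.map_apply]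
  fin_cases i <;> fin_cases j <;> simp [blockSL]

lemma blockSL_mem_Gam {a b c d e f : ℤ} (h : a * d - b * c = 1) :
    blockSL (a : ℝ) b c d e f (by exact_mod_cast h) ∈ Gam :=
  ⟨_, map_blockSL h⟩

/-- A pair of integers that generates `ℤ/qℤ` lifts, modulo `q`, to the first row of a matrix in
`SL₂(ℤ)`. -/
lemma exists_first_row_modEq {q : ℕ} {m n : ℤ} (h : ∃ x y z : ℤ, x * m + y * n + z * q = 1) :
    ∃ a b c d e f : ℤ, a * d - b * c = 1 ∧ m = a + q * e ∧ n = b + q * f := by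
  obtain ⟨x, y, z, h⟩ := h
  obtain ⟨g, m', n', s, r, rfl, rfl, hsr⟩ : ∃ g m' n' s r : ℤ,
      m = g * m' ∧ n = g * n' ∧ m' * s + n' * r = 1 := by
    by_cases h0 : gcd m n = 0
    · rw [gcd_eq_zero_iff] at h0
      exact ⟨0, 1, 0, 1, 0, by simp [h0.1], by simp [h0.2], by simp⟩
    · obtain ⟨m', hm⟩ := gcd_dvd_left m n
      obtain ⟨n', hn⟩ := gcd_dvd_right m n
      have hb : gcd m n = m * Int.gcdA m n + n * Int.gcdB m n := Int.gcd_eq_gcd_ab m n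
      refine ⟨gcd m n, m', n', Int.gcdA m n, Int.gcdB m n, hm, hn, mul_left_cancel₀ h0 ?_⟩
      calc gcd m n * (m' * Int.gcdA m n + n' * Int.gcdB m n)
          = (gcd m n * m') * Int.gcdA m n + (gcd m n * n') * Int.gcdB m n := by ring
        _ = gcd m n * 1 := by rw [← hm, ← hn, ← hb, mul_one]
  -- The pair is `(g, 0)` times the matrix with rows `(m', n')` and `(-r, s)`; replace `(g, 0)` by
  -- the primitive pair `(g, q)`.
  refine ⟨g * m' - q * r, g * n' + q * s, -z * m' - (x * m' + y * n') * r,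
    -z * n' + (x * m' + y * n') * s, r, -s, ?_, by ring, by ring⟩
  linear_combination h * (m' * s + n' * r) + hsr

lemma blockSL_inv_apply_two {a b c d e f : ℝ} (h : a * d - b * c = 1) (r : Fin 3) :
    ((blockSL a b c d e f h : G)⁻¹ : G) r 2 = if r = 2 then 1 else 0 := by
  rw [Matrix.SpecialLinearGroup.coe_inv, Matrix.adjugate_fin_three]
  fin_cases r <;> simp [blockSL]
  linarith

/-- The lattice `{(m, α m + k, (p₂ m - p₁ k) / q + l)}` lies in `M⁽¹⁾_q`. -/
lemma mk_mem_M₁ {α : ℝ} {q : ℕ} {p₁ p₂ : ℤ} (hq : 0 < q)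
    (h : ∃ x y z : ℤ, x * p₁ + y * p₂ + z * q = 1) :
    ((blockSL 1 0 α 1 ((p₂ : ℝ) / q) (-(p₁ : ℝ) / q) (by ring) : G) : X3) ∈ M₁ q := by
  obtain ⟨a, b, c, d, e, f, h1, h2, h3⟩ := exists_first_row_modEq (q := q) (m := p₂) (n := -p₁)
    (by obtain ⟨x, y, z, h⟩ := h; exact ⟨y, -x, z, by linarith⟩)
  have hqR : (q : ℝ) ≠ 0 := by exact_mod_cast hq.ne'
  refine (mk_mem_orbit_iff mem_H₁_iff _ _).2 ⟨_, blockSL_mem_Gam (e := e) (f := f) h1, ?_⟩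
  have hR : (a : ℝ) * d - b * c = 1 := by exact_mod_cast h1
  have h2' : (p₂ : ℝ) = a + q * e := by exact_mod_cast h2
  have h3' : -(p₁ : ℝ) = b + q * f := by exact_mod_cast h3
  have hmul : hMat 0 (q : ℝ)⁻¹ * blockSL (a : ℝ) b c d e f hR =
      blockSL (a : ℝ) b c d ((q : ℝ)⁻¹ * a + e) ((q : ℝ)⁻¹ * b + f) hR := by
    ext i j
    rw [Matrix.SpecialLinearGroup.coe_mul, Matrix.mul_apply, Fin.sum_univ_three]
    fin_cases i <;> fin_cases j <;> simp [hMat, blockSL]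
  rw [hmul]
  ext r k
  rw [projConj_apply, projConj_apply, blockSL_inv_apply_two, blockSL_inv_apply_two]
  congr 1
  fin_cases k <;> simp [blockSL, h2', h3'] <;> field_simp

/-- The unipotent matrix `I + u E₃₂`. -/
def shear (u : ℝ) : G := ⟨!![1, 0, 0; 0, 1, 0; 0, u, 1], by simp [Matrix.det_fin_three]⟩

lemma continuous_shear : Continuous shear := by
  refine Continuous.subtype_mk ?_ _
  refine continuous_matrix fun i j => ?_
  fin_cases i <;> fin_cases j <;> simp [continuous_const, continuous_id']

lemma shear_zero : shear 0 = 1 := by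
  ext i j
  fin_cases i <;> fin_cases j <;> simp [shear]

/-- Points of the first trajectory differ from points of `M⁽¹⁾_q` by a shear that the flow
contracts. -/
lemma shear_smul_a₁_smul_mem_M₁ {α β : ℝ} {q : ℕ} {p₁ p₂ : ℤ} (hq : 0 < q)
    (hβ : β = (p₁ : ℝ) / q * α + (p₂ : ℝ) / q)
    (h : ∃ x y z : ℤ, x * p₁ + y * p₂ + z * q = 1) (t : ℝ) :
    shear (-((p₁ : ℝ) / q) * Real.exp (-t)) • a₁ t • xPt α β ∈ M₁ q := by
  have key : shear (-((p₁ : ℝ) / q) * Real.exp (-t)) * (a₁ t * hMat α β) =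
      a₁ t * blockSL 1 0 α 1 ((p₂ : ℝ) / q) (-(p₁ : ℝ) / q) (by ring) := by
    have e : Real.exp (-t) * Real.exp t = 1 := by rw [← Real.exp_add]; simp
    ext i j
    simp only [Matrix.SpecialLinearGroup.coe_mul, Matrix.mul_apply, Fin.sum_univ_three]
    fin_cases i <;> fin_cases j <;> simp [hMat, blockSL, shear, a₁, hβ]
    · linear_combination (-(p₁ : ℝ) / q * α) * e
    · linear_combination (-(p₁ : ℝ) / q) * e
  rw [xPt, smul_smul, smul_smul, mul_assoc, key, ← smul_smul, smul_eGam]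
  exact MulAction.mem_orbit_of_mem_orbit (⟨a₁ t, A_le_H₁ (a₁_mem_A t)⟩ : H₁) (mk_mem_M₁ hq h)

/-- Limits of `a⁽¹⁾(t) x_v` along filters that tend to infinity are in `M⁽¹⁾_q`. -/
lemma mem_M₁_of_tendsto {α β : ℝ} {q : ℕ} {p₁ p₂ : ℤ} (hq : 0 < q)
    (hβ : β = (p₁ : ℝ) / q * α + (p₂ : ℝ) / q)
    (h : ∃ x y z : ℤ, x * p₁ + y * p₂ + z * q = 1) {F : Filter ℝ} [F.NeBot] (hF : F ≤ atTop)
    {y : X3} (hy : Tendsto (fun t => a₁ t • xPt α β) F (𝓝 y)) : y ∈ M₁ q := by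
  have h0 : Tendsto (fun t : ℝ => shear (-((p₁ : ℝ) / q) * Real.exp (-t))) F (𝓝 1) := by
    rw [← shear_zero]
    refine (continuous_shear.tendsto 0).comp ?_
    have := (Real.tendsto_exp_neg_atTop_nhds_zero.mono_left hF).const_mul (-((p₁ : ℝ) / q))
    simpa using this
  have := h0.smul hy
  rw [one_smul] at this
  exact (isClosed_M₁ hq.ne').mem_of_tendsto this
    (Eventually.of_forall (shear_smul_a₁_smul_mem_M₁ hq hβ h))

lemma continuous_a₁ : Continuous a₁ := by
  refine Continuous.subtype_mk ?_ _
  refine Continuous.matrix_diagonal (continuous_pi fun i => ?_)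
  fin_cases i <;> simp <;> fun_prop

lemma isClosed_Gam : IsClosed (Gam : Set G) := by
  have := (Real.isClosedEmbedding_intCast.specialLinearGroup_map (n := Fin 3)
    (f := Int.castRingHom ℝ)).isClosed_range
  simpa [Gam, MonoidHom.coe_range] using this

/-- The space of lattices is Hausdorff, as `Γ` is closed; Mathlib's instance for quotient groups is
for normal subgroups. -/
instance : T2Space X3 := by
  rw [t2Space_iff_of_isOpenQuotientMap (QuotientGroup.isOpenQuotientMap_mk (N := Gam))]
  have : {q : G × G | (q.1 : X3) = (q.2 : X3)} = (fun q : G × G => q.1⁻¹ * q.2) ⁻¹' Gam := by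
    ext q
    exact QuotientGroup.eq
  rw [this]
  exact isClosed_Gam.preimage (by fun_prop)

/-- The limit points of the first trajectory lie in `M⁽¹⁾_q`. -/
lemma Om_a₁_subset_M₁ {α β : ℝ} {q : ℕ} {p₁ p₂ : ℤ} (hq : 0 < q)
    (hβ : β = (p₁ : ℝ) / q * α + (p₂ : ℝ) / q)
    (h : ∃ x y z : ℤ, x * p₁ + y * p₂ + z * q = 1) : Om a₁ (xPt α β) ⊆ M₁ q := by
  rintro y ⟨hy, hy'⟩
  refine (?_ : ∃ U : Ultrafilter ℝ, ↑U ≤ atTop ∧ Tendsto (fun t => a₁ t • xPt α β) U (𝓝 y)).elim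
    fun U hU => mem_M₁_of_tendsto hq hβ h hU.1 hU.2
  -- The part of the trajectory up to time `T` is compact and does not contain `y`.
  rw [← mapClusterPt_iff_ultrafilter, mapClusterPt_iff_frequently]
  intro s hs
  rw [frequently_atTop]
  intro T
  have hc : Continuous fun t => a₁ t • xPt α β :=
    Continuous.smul (f := a₁) (g := fun _ => xPt α β) continuous_a₁ continuous_const
  have hK : IsClosed ((fun t => a₁ t • xPt α β) '' Icc 0 T) := (isCompact_Icc.image hc).isClosed
  have hyK : y ∉ (fun t => a₁ t • xPt α β) '' Icc 0 T := by
    rintro ⟨t, ht, rfl⟩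
    exact hy' ⟨t, ht.1, rfl⟩
  obtain ⟨z, ⟨hz, hzK⟩, t, ht, rfl⟩ :=
    mem_closure_iff_nhds.1 hy _ (inter_mem hs (hK.isOpen_compl.mem_nhds hyK))
  refine ⟨t, ?_, hz⟩
  by_contra! hlt
  exact hzK ⟨t, ⟨ht, hlt.le⟩, rfl⟩

/-! ### The trajectory along the first ray returns to a compact set -/

lemma isCompact_entries_le (C : ℝ) : IsCompact {g : G | ∀ i j, |g i j| ≤ C} := by
  have hK : IsCompact ((univ : Set (Fin 3)).pi fun _ =>
      (univ : Set (Fin 3)).pi fun _ => Icc (-C) C) :=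
    isCompact_univ_pi fun _ => isCompact_univ_pi fun _ => isCompact_Icc
  have := Matrix.SpecialLinearGroup.isClosedEmbedding_val (n := Fin 3) (R := ℝ)
    |>.isCompact_preimage hK
  refine (Set.Subset.antisymm ?_ ?_ : _ = {g : G | ∀ i j, |g i j| ≤ C}) ▸ this
  · exact fun g hg i j => abs_le.2 (hg i trivial j trivial)
  · exact fun g hg i _ j _ => abs_le.1 (hg i j)

/-- An irrational number has rational approximations `r` of arbitrarily large denominator with
`|α - r| < 1 / r.den ^ 2`. -/
lemma exists_rat_approx {α : ℝ} (hα : Irrational α) (N : ℕ) :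
    ∃ r : ℚ, N < r.den ∧ |α - r| < 1 / (r.den : ℝ) ^ 2 := by
  by_contra! hcon
  refine Real.infinite_rat_abs_sub_lt_one_div_den_sq_of_irrational hα ?_
  -- Rational numbers of bounded denominator near `α` correspond to finitely many fractions.
  refine Set.Finite.of_finite_image (f := fun r : ℚ => (r.num, r.den))
    (((Set.finite_Icc (-(⌈|α| + 1⌉ * N : ℤ)) (⌈|α| + 1⌉ * N)).prod
      (Set.finite_Icc 0 N)).subset ?_) ?_
  · rintro _ ⟨r, hr, rfl⟩
    have hr : |α - r| < 1 / (r.den : ℝ) ^ 2 := hr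
    have hN : r.den ≤ N := by
      by_contra! h
      exact absurd hr (hcon r h).not_gt
    refine ⟨?_, Nat.zero_le _, hN⟩
    have hd : (1 : ℝ) ≤ r.den := by exact_mod_cast r.den_pos
    have h1 : |α - r| < 1 := hr.trans_le (by
      rw [div_le_one (by positivity)]
      nlinarith)
    have h2 : |(r : ℝ)| ≤ ⌈|α| + 1⌉ := by
      refine le_trans ?_ (Int.le_ceil _)
      have := abs_sub_abs_le_abs_sub (r : ℝ) α
      rw [abs_sub_comm] at this
      linarith
    have h3 : |(r.num : ℝ)| ≤ ⌈|α| + 1⌉ * N := by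
      have e : (r.num : ℝ) = r * r.den := by exact_mod_cast (Rat.mul_den_eq_num r).symm
      rw [e, abs_mul, abs_of_pos (by linarith : (0 : ℝ) < r.den)]
      have : (r.den : ℝ) ≤ N := by exact_mod_cast hN
      exact mul_le_mul h2 this (by linarith) (le_trans (abs_nonneg _) h2)
    have h4 : |r.num| ≤ ⌈|α| + 1⌉ * N := by exact_mod_cast h3
    exact abs_le.1 h4
  · intro r _ s _ h
    simp only [Prod.mk.injEq] at h
    exact Rat.ext h.1 h.2

/-- Along the first ray the lattice `x_v` returns, at arbitrarily large times, to the compact set of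
lattices with a basis of vectors with entries at most `2`. -/
lemma exists_a₁_smul_mem {α β : ℝ} (hα : Irrational α) (T : ℝ) :
    ∃ t ≥ T, a₁ t • xPt α β ∈ ((↑) : G → X3) '' {g : G | ∀ i j, |g i j| ≤ 2} := by
  obtain ⟨r, hr, hr'⟩ := exists_rat_approx hα ⌈Real.exp T⌉₊
  have hd0 : (0 : ℝ) < r.den := by exact_mod_cast r.den_pos
  have hT : Real.exp T ≤ r.den := (Nat.le_ceil _).trans (by exact_mod_cast hr.le)
  obtain ⟨u, v, huv⟩ : ∃ u v : ℤ, r.den * v + r.num * u = 1 := by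
    have := (Int.isCoprime_iff_gcd_eq_one (m := r.den) (n := r.num)).2 (by
      have := r.reduced
      rw [Int.gcd_comm]
      exact this)
    obtain ⟨v, u, h⟩ := this
    exact ⟨u, v, by linarith⟩
  -- The matrix with columns `(r.den, -r.num)` and `(m, n)` has determinant one, and
  -- `0 ≤ m < r.den`.
  set m : ℤ := u % r.den with hm
  set n : ℤ := v + r.num * (u / r.den) with hn
  have hdet : (r.den : ℤ) * n - m * (-r.num) = 1 := by
    have := Int.emod_add_mul_ediv u r.den
    rw [← hm] at this
    rw [hn]
    linear_combination huv + r.num * this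
  have hdZ : (0 : ℤ) < r.den := by exact_mod_cast r.den_pos
  have hm0 : (0 : ℝ) ≤ m := by exact_mod_cast Int.emod_nonneg u hdZ.ne'
  have hm1 : (m : ℝ) ≤ r.den := by exact_mod_cast (Int.emod_lt_of_pos u hdZ).le
  have hdetR : (r.den : ℝ) * n + m * r.num = 1 := by
    have : (r.den : ℤ) * n + m * r.num = 1 := by linarith
    exact_mod_cast this
  have e1 : (r.num : ℝ) = r * r.den := by exact_mod_cast (Rat.mul_den_eq_num r).symm
  have h1 : |(r.den : ℝ) * (α * r.den - r.num)| ≤ 1 := by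
    have : (r.den : ℝ) * (α * r.den - r.num) = (α - r) * (r.den : ℝ) ^ 2 := by rw [e1]; ring
    rw [this, abs_mul, abs_of_pos (by positivity : (0 : ℝ) < (r.den : ℝ) ^ 2)]
    exact ((lt_div_iff₀ (by positivity)).1 hr').le
  have h2 : |(r.den : ℝ) * (α * m + n)| ≤ 2 := by
    have : (r.den : ℝ) * (α * m + n) = m / r.den * (r.den * (α * r.den - r.num)) + 1 := by
      field_simp
      linear_combination hdetR
    rw [this]
    refine (abs_add_le _ _).trans ?_
    rw [abs_mul, abs_of_nonneg (by positivity : 0 ≤ (m : ℝ) / r.den), abs_one]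
    have : (m : ℝ) / r.den ≤ 1 := (div_le_one hd0).2 hm1
    nlinarith [mul_le_one₀ this (abs_nonneg _) h1]
  -- At time `log r.den` the first coordinates are divided, and the second ones multiplied, by
  -- `r.den`; the third coordinates do not change and are reduced modulo one by the last basis
  -- vector.
  refine ⟨Real.log r.den, (Real.le_log_iff_exp_le hd0).2 hT,
    a₁ (Real.log r.den) * (hMat α β * Matrix.SpecialLinearGroup.map (Int.castRingHom ℝ)
      (blockSL (r.den : ℤ) m (-r.num) n (-⌊β * r.den⌋) (-⌊β * m⌋) hdet)), ?_, ?_⟩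
  · have hfr : ∀ x : ℝ, |x - ⌊x⌋| ≤ 2 := fun x => by
      rw [Int.self_sub_floor, Int.abs_fract]
      linarith [Int.fract_lt_one x]
    have hlog : Real.exp (-Real.log r.den) = (r.den : ℝ)⁻¹ := by
      rw [Real.exp_neg, Real.exp_log hd0]
    rw [map_blockSL]
    rw [abs_mul, abs_of_pos hd0] at h1 h2
    intro i j
    simp only [Matrix.SpecialLinearGroup.coe_mul, Matrix.mul_apply, Fin.sum_univ_three]
    fin_cases i <;> fin_cases j <;>
      simp [hMat, blockSL, a₁, hlog, Real.exp_log hd0, hd0.ne', ← sub_eq_add_neg]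
    · rw [abs_of_nonneg hm0, ← div_eq_inv_mul, div_le_iff₀ hd0]
      linarith
    · linarith
    · exact h2
    · exact hfr _
    · exact hfr _
  · rw [xPt, smul_smul, smul_eGam, mk_eq_mk_iff]
    refine ⟨_, inv_mem ⟨blockSL (r.den : ℤ) m (-r.num) n (-⌊β * r.den⌋) (-⌊β * m⌋) hdet, rfl⟩, ?_⟩
    group

/-- The first trajectory has limit points: it returns to a compact set, and its limits are in
`M⁽¹⁾_q`, which is disjoint from the orbit. -/
lemma Om_a₁_nonempty {α β : ℝ} (hα : Irrational α) (hβ' : Irrational β) {q : ℕ} {p₁ p₂ : ℤ}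
    (hq : 0 < q) (hβ : β = (p₁ : ℝ) / q * α + (p₂ : ℝ) / q)
    (h : ∃ x y z : ℤ, x * p₁ + y * p₂ + z * q = 1) : (Om a₁ (xPt α β)).Nonempty := by
  choose t ht htK using fun n : ℕ => exists_a₁_smul_mem (β := β) hα n
  have hK : IsCompact (((↑) : G → X3) '' {g : G | ∀ i j, |g i j| ≤ 2}) :=
    (isCompact_entries_le 2).image QuotientGroup.continuous_mk
  obtain ⟨y, -, φ, hφ, hy⟩ : ∃ y ∈ ((↑) : G → X3) '' {g : G | ∀ i j, |g i j| ≤ 2},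
      ∃ F : Ultrafilter ℕ, (F : Filter ℕ) ≤ atTop ∧
        Tendsto (fun n => a₁ (t n) • xPt α β) F (𝓝 y) := by
    obtain ⟨y, hyK, hy⟩ := hK.exists_mapClusterPt_of_frequently (l := atTop)
      (f := fun n => a₁ (t n) • xPt α β) (Frequently.of_forall htK)
    exact ⟨y, hyK, mapClusterPt_iff_ultrafilter.1 hy⟩
  have ht' : Tendsto t atTop atTop := tendsto_atTop_mono ht tendsto_natCast_atTop_atTop
  have hyM : y ∈ M₁ q :=
    mem_M₁_of_tendsto hq hβ h (F := map t φ) (ht'.mono_left hφ) hy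
  refine ⟨y, mem_closure_of_tendsto hy ?_, ?_⟩
  · exact Eventually.of_forall fun n => ⟨t n, le_trans (Nat.cast_nonneg n) (ht n), rfl⟩
  · rintro ⟨s, -, rfl⟩
    exact (disjoint_orbit_xPt hα hβ' hq.ne' hq.ne').le_bot
      ⟨⟨⟨a₁ s, a₁_mem_A s⟩, rfl⟩, Or.inl hyM⟩

/-! ### Involutions of `SL₃` acting on the space of lattices -/

/-- The self-homeomorphism of `X₃` induced by a continuous involutive endomorphism of `G` that
preserves `Γ`. -/
def quotientInvolution (θ : G →* G) (hc : Continuous θ) (hi : ∀ g, θ (θ g) = g)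
    (hΓ : ∀ γ ∈ Gam, θ γ ∈ Gam) : X3 ≃ₜ X3 :=
  let f : X3 → X3 := Quotient.map' θ fun g k h => by
    rw [QuotientGroup.leftRel_apply] at h ⊢
    rw [← map_inv, ← map_mul]
    exact hΓ _ h
  have hf : Continuous f := by
    rw [← (QuotientGroup.isOpenQuotientMap_mk (N := Gam)).continuous_comp_iff]
    exact QuotientGroup.continuous_mk.comp hc
  have hff : Function.Involutive f := by
    intro x
    obtain ⟨g, rfl⟩ := QuotientGroup.mk_surjective x
    exact congrArg _ (hi g)
  { toFun := f, invFun := f, left_inv := hff, right_inv := hff,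
    continuous_toFun := hf, continuous_invFun := hf }

section

variable {θ : G →* G} {hc : Continuous θ} {hi : ∀ g, θ (θ g) = g} {hΓ : ∀ γ ∈ Gam, θ γ ∈ Gam}

lemma quotientInvolution_mk (g : G) : quotientInvolution θ hc hi hΓ (g : X3) = (θ g : X3) := rfl

lemma quotientInvolution_smul_eGam (g : G) :
    quotientInvolution θ hc hi hΓ (g • eGam) = θ g • eGam := by
  rw [smul_eGam, smul_eGam, quotientInvolution_mk]

lemma quotientInvolution_smul (g : G) (x : X3) :
    quotientInvolution θ hc hi hΓ (g • x) = θ g • quotientInvolution θ hc hi hΓ x := by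
  obtain ⟨k, rfl⟩ := QuotientGroup.mk_surjective x
  exact congrArg ((↑) : G → X3) (map_mul θ g k)

lemma image_orbit (K : Subgroup G) (x : X3) :
    quotientInvolution θ hc hi hΓ '' MulAction.orbit (K.comap θ) x =
      MulAction.orbit K (quotientInvolution θ hc hi hΓ x) := by
  ext y
  constructor
  · rintro ⟨_, ⟨k, rfl⟩, rfl⟩
    exact ⟨⟨θ k, k.2⟩, (quotientInvolution_smul _ _).symm⟩
  · rintro ⟨k, rfl⟩
    refine ⟨θ k • x, ⟨⟨θ k, ?_⟩, rfl⟩, ?_⟩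
    · rw [Subgroup.mem_comap, hi]
      exact k.2
    · rw [quotientInvolution_smul, hi]
      rfl

lemma image_Om {c c' : ℝ → G} (hcc : ∀ t, θ (c t) = c' t) (x : X3) :
    quotientInvolution θ hc hi hΓ '' Om c x = Om c' (quotientInvolution θ hc hi hΓ x) := by
  have : quotientInvolution θ hc hi hΓ '' traj c x = traj c' (quotientInvolution θ hc hi hΓ x) := by
    simp only [traj, image_image, quotientInvolution_smul, hcc]
  rw [Om, Om, image_sdiff (quotientInvolution θ hc hi hΓ).injective, Homeomorph.image_closure, this]

lemma isRegularPt_of_quotientInvolution {K : Subgroup G} (hK : K.comap θ = K) {x : X3}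
    (h : IsRegularPt K (quotientInvolution θ hc hi hΓ x)) : IsRegularPt K x := by
  obtain ⟨L, hL, hKL, e⟩ := h
  refine ⟨L.comap θ, hL.preimage hc, fun k hk => hKL ?_, ?_⟩
  · rw [← hK] at hk
    exact hk
  · apply (quotientInvolution θ hc hi hΓ).injective.image_injective
    rw [image_orbit, Homeomorph.image_closure, ← e, ← image_orbit, hK]

end

/-- The automorphism of `SL₃` that exchanges the second and third coordinate axes. -/
def swapSL (R : Type*) [CommRing R] :
    Matrix.SpecialLinearGroup (Fin 3) R →* Matrix.SpecialLinearGroup (Fin 3) R where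
  toFun g := ⟨(g : Matrix (Fin 3) (Fin 3) R).submatrix (Equiv.swap 1 2) (Equiv.swap 1 2), by
    rw [Matrix.det_submatrix_equiv_self, g.2]⟩
  map_one' := by
    ext i j
    simp [Matrix.one_apply]
  map_mul' g k := by
    apply Subtype.ext
    exact (Matrix.submatrix_mul_equiv (g : Matrix (Fin 3) (Fin 3) R)
      (k : Matrix (Fin 3) (Fin 3) R) _ (Equiv.swap 1 2) _).symm

lemma swapSL_apply {R : Type*} [CommRing R] (g : Matrix.SpecialLinearGroup (Fin 3) R)
    (i j : Fin 3) : swapSL R g i j = g (Equiv.swap 1 2 i) (Equiv.swap 1 2 j) := rfl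

lemma swapSL_swapSL {R : Type*} [CommRing R] (g : Matrix.SpecialLinearGroup (Fin 3) R) :
    swapSL R (swapSL R g) = g := by
  ext i j
  simp [swapSL_apply]

lemma continuous_swapSL : Continuous (swapSL ℝ) := by
  refine Continuous.subtype_mk ?_ _
  exact continuous_subtype_val.matrix_submatrix _ _

lemma swapSL_mem_Gam : ∀ γ ∈ Gam, swapSL ℝ γ ∈ Gam := by
  rintro _ ⟨δ, rfl⟩
  exact ⟨swapSL ℤ δ, by ext i j; rfl⟩

/-- The inverse transpose automorphism of `SL₃`. -/
def invTranspose (R : Type*) [CommRing R] :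
    Matrix.SpecialLinearGroup (Fin 3) R →* Matrix.SpecialLinearGroup (Fin 3) R where
  toFun g := (g⁻¹).transpose
  map_one' := by
    apply Subtype.ext
    simp
  map_mul' g k := by
    apply Subtype.ext
    simp

lemma coe_invTranspose {R : Type*} [CommRing R] (g : Matrix.SpecialLinearGroup (Fin 3) R) :
    (invTranspose R g : Matrix (Fin 3) (Fin 3) R) =
      (Matrix.adjugate (g : Matrix (Fin 3) (Fin 3) R)).transpose := rfl

lemma invTranspose_invTranspose {R : Type*} [CommRing R]
    (g : Matrix.SpecialLinearGroup (Fin 3) R) : invTranspose R (invTranspose R g) = g := by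
  apply Subtype.ext
  rw [coe_invTranspose, coe_invTranspose, Matrix.adjugate_transpose, Matrix.transpose_transpose,
    Matrix.adjugate_adjugate _ (by simp)]
  simp

lemma continuous_invTranspose : Continuous (invTranspose ℝ) := by
  refine continuous_induced_rng.mpr ?_
  exact continuous_subtype_val.matrix_adjugate.matrix_transpose

lemma invTranspose_mem_Gam : ∀ γ ∈ Gam, invTranspose ℝ γ ∈ Gam := by
  rintro _ ⟨δ, rfl⟩
  refine ⟨invTranspose ℤ δ, ?_⟩
  apply Subtype.ext
  rw [coe_invTranspose, Matrix.SpecialLinearGroup.map_apply_coe, coe_invTranspose,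
    Matrix.SpecialLinearGroup.map_apply_coe, ← RingHom.map_adjugate]
  rfl

/-- The self-homeomorphism of `X₃` that exchanges the second and third coordinate. -/
def swapX3 : X3 ≃ₜ X3 :=
  quotientInvolution (swapSL ℝ) continuous_swapSL swapSL_swapSL swapSL_mem_Gam

lemma swapSL_hMat (a b : ℝ) : swapSL ℝ (hMat a b) = hMat b a := by
  ext i j
  rw [swapSL_apply]
  fin_cases i <;> fin_cases j <;> simp [hMat, Equiv.swap_apply_def]

lemma swapX3_xPt (a b : ℝ) : swapX3 (xPt a b) = xPt b a := by
  rw [swapX3, xPt, quotientInvolution_smul_eGam, swapSL_hMat, xPt]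

lemma swapSL_a₁ (t : ℝ) : swapSL ℝ (a₁ t) = a₂ t := by
  ext i j
  rw [swapSL_apply, coe_a₁, coe_a₂]
  fin_cases i <;> fin_cases j <;> simp [Equiv.swap_apply_def]

lemma swapX3_image_M₁ (q : ℕ) : swapX3 '' M₁ q = M₂ q := by
  have h : H₁ = H₂.comap (swapSL ℝ) := by
    ext g
    show (g 0 2 = 0 ∧ g 1 2 = 0 ∧ g 2 0 = 0 ∧ g 2 1 = 0) ↔
      (swapSL ℝ g 0 1 = 0 ∧ swapSL ℝ g 1 0 = 0 ∧ swapSL ℝ g 1 2 = 0 ∧ swapSL ℝ g 2 1 = 0)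
    simp only [swapSL_apply]
    simp [Equiv.swap_apply_def]
    tauto
  rw [M₁, h, swapX3, image_orbit, quotientInvolution_smul_eGam, swapSL_hMat, M₂]

lemma Om_a₂_eq (α β : ℝ) : Om a₂ (xPt α β) = swapX3 '' Om a₁ (xPt β α) := by
  rw [swapX3, image_Om swapSL_a₁, ← swapX3, swapX3_xPt]

lemma comap_invTranspose_A : A.comap (invTranspose ℝ) = A := by
  have h : A ≤ A.comap (invTranspose ℝ) := by
    intro a ha
    obtain ⟨s, hs, has⟩ := inv_mem ha
    refine ⟨s, hs, ?_⟩
    rw [coe_invTranspose, ← Matrix.SpecialLinearGroup.coe_inv, has, Matrix.diagonal_transpose]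
  refine le_antisymm (fun a ha => ?_) h
  have := h ha
  rwa [Subgroup.mem_comap, invTranspose_invTranspose] at this

lemma isRegularPt_xPt_of_zPt {a b : ℝ} (h : IsRegularPt A (zPt a b)) :
    IsRegularPt A (xPt (-a) (-b)) := by
  refine isRegularPt_of_quotientInvolution (θ := invTranspose ℝ) (hc := continuous_invTranspose)
    (hi := invTranspose_invTranspose) (hΓ := invTranspose_mem_Gam) comap_invTranspose_A ?_
  have : invTranspose ℝ (hMat (-a) (-b)) = gMat a b := by
    ext i j
    rw [coe_invTranspose, Matrix.adjugate_fin_three]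
    fin_cases i <;> fin_cases j <;> simp [hMat, gMat]
  rwa [xPt, quotientInvolution_smul_eGam, this]

/-! ### The closure of the orbit -/

lemma smul_closure_orbit_subset {a : G} (ha : a ∈ A) {x y : X3}
    (hy : y ∈ closure (MulAction.orbit A x)) : a • y ∈ closure (MulAction.orbit A x) := by
  have h : (fun z : X3 => a • z) '' MulAction.orbit A x ⊆ MulAction.orbit A x := by
    rintro _ ⟨_, ⟨b, rfl⟩, rfl⟩
    exact MulAction.mem_orbit_of_mem_orbit (⟨a, ha⟩ : A) ⟨b, rfl⟩
  exact closure_mono h (image_closure_subset_closure_image (continuous_const_smul a) ⟨y, hy, rfl⟩)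

lemma traj_subset_orbit {c : ℝ → G} (hc : ∀ t, c t ∈ A) (x : X3) :
    traj c x ⊆ MulAction.orbit A x := by
  rintro _ ⟨t, -, rfl⟩
  exact ⟨⟨c t, hc t⟩, rfl⟩

lemma ASat_Om_subset_closure {c : ℝ → G} (hc : ∀ t, c t ∈ A) (x : X3) :
    ASat (Om c x) ⊆ closure (MulAction.orbit A x) := by
  rintro _ ⟨a, ha, w, hw, rfl⟩
  exact smul_closure_orbit_subset ha (closure_mono (traj_subset_orbit hc x) hw.1)

/-- If `z` converges to `y` along an ultrafilter on which `z` is in `b c(t) x` for bounded `b ∈ A`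
and `t > 0`, then `y` is in `A Om c x`, unless it is in the orbit. -/
lemma mem_ASat_of_ultrafilter {c : ℝ → G} (hc : ∀ t, c t ∈ A) {x y : X3} {u : Ultrafilter X3}
    (hu : ↑u ≤ 𝓝 y) {C : ℝ}
    (h : ∀ᶠ z in (u : Filter X3), ∃ b ∈ boxA C, ∃ t : ℝ, 0 < t ∧ z = (b * c t) • x)
    (hy : y ∉ MulAction.orbit A x) : y ∈ ASat (Om c x) := by
  have hex : ∀ z : X3, ∃ b : G, (∃ b ∈ boxA C, ∃ t : ℝ, 0 < t ∧ z = (b * c t) • x) →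
      b ∈ boxA C ∧ b⁻¹ • z ∈ traj c x := by
    intro z
    by_cases hz : ∃ b ∈ boxA C, ∃ t : ℝ, 0 < t ∧ z = (b * c t) • x
    · obtain ⟨b, hb, t, ht, rfl⟩ := hz
      refine ⟨b, fun _ => ⟨hb, t, ht.le, ?_⟩⟩
      simp [mul_smul]
    · exact ⟨1, fun h => absurd h hz⟩
  choose b hb using hex
  have hbox : ∀ᶠ z in (u : Filter X3), b z ∈ boxA C := h.mono fun z hz => (hb z hz).1
  have htraj : ∀ᶠ z in (u : Filter X3), (b z)⁻¹ • z ∈ traj c x := h.mono fun z hz => (hb z hz).2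
  obtain ⟨b₀, hb₀, hlim⟩ := (isCompact_boxA C).ultrafilter_le_nhds (u.map b)
    (le_principal_iff.2 hbox)
  have hlim' : Tendsto b u (𝓝 b₀) := hlim
  have hw : b₀⁻¹ • y ∈ closure (traj c x) :=
    mem_closure_of_tendsto ((hlim'.inv).smul (tendsto_id'.2 hu)) htraj
  have hb₀A := boxA_subset C hb₀
  refine ⟨b₀, hb₀A, b₀⁻¹ • y, ⟨hw, fun hmem => hy ?_⟩, smul_inv_smul _ _⟩
  have : b₀ • b₀⁻¹ • y ∈ MulAction.orbit A x :=
    MulAction.mem_orbit_of_mem_orbit (⟨b₀, hb₀A⟩ : A) (traj_subset_orbit hc x hmem)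
  rwa [smul_inv_smul] at this

/-- A limit point of `A x_v` outside the orbit is approached along bounded translates of one of the
two rays. -/
lemma closure_orbit_diff_subset {α β : ℝ} {q : ℕ} {p₁ p₂ : ℤ} (hq : 0 < q)
    (hβ : β = (p₁ : ℝ) / q * α + (p₂ : ℝ) / q) :
    closure (MulAction.orbit A (xPt α β)) \ MulAction.orbit A (xPt α β) ⊆
      ASat (Om a₁ (xPt α β)) ∪ ASat (Om a₂ (xPt α β)) := by
  rintro y ⟨hy, hy'⟩
  obtain ⟨u, hu, huy⟩ := mem_closure_iff_ultrafilter.1 hy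
  obtain ⟨C, hC⟩ := exists_mem_boxA_mul hq hβ y
  have h : ∀ᶠ z in (u : Filter X3),
      (∃ b ∈ boxA C, ∃ t : ℝ, 0 < t ∧ z = (b * a₁ t) • xPt α β) ∨
        (∃ b ∈ boxA C, ∃ t : ℝ, 0 < t ∧ z = (b * a₂ t) • xPt α β) := by
    filter_upwards [huy hC, hu]
    rintro _ hz ⟨a, rfl⟩
    obtain ⟨b, hb, t, ht, h | h⟩ := hz a a.2 rfl
    · exact Or.inl ⟨b, hb, t, ht, by rw [← h]; rfl⟩
    · exact Or.inr ⟨b, hb, t, ht, by rw [← h]; rfl⟩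
  rcases Ultrafilter.eventually_or.1 h with h | h
  · exact Or.inl (mem_ASat_of_ultrafilter a₁_mem_A huy h hy')
  · exact Or.inr (mem_ASat_of_ultrafilter a₂_mem_A huy h hy')

lemma ASat_subset_M₁ {S : Set X3} {q : ℕ} (h : S ⊆ M₁ q) : ASat S ⊆ M₁ q := by
  rintro _ ⟨a, ha, w, hw, rfl⟩
  exact MulAction.mem_orbit_of_mem_orbit (⟨a, A_le_H₁ ha⟩ : H₁) (h hw)

lemma ASat_subset_M₂ {S : Set X3} {q : ℕ} (h : S ⊆ M₂ q) : ASat S ⊆ M₂ q := by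
  rintro _ ⟨a, ha, w, hw, rfl⟩
  exact MulAction.mem_orbit_of_mem_orbit (⟨a, A_le_H₂ ha⟩ : H₂) (h hw)

lemma ASat_nonempty {S : Set X3} (h : S.Nonempty) : (ASat S).Nonempty :=
  h.elim fun w hw => ⟨w, 1, one_mem _, w, hw, one_smul _ _⟩

section reducedForms

variable {α β : ℝ} {q q' : ℕ} {p₁ p₂ p₁' p₂' : ℤ}

lemma ASat_Om_a₁_subset (h : IsReducedForm β α q p₁ p₂) : ASat (Om a₁ (xPt α β)) ⊆ M₁ q :=
  ASat_subset_M₁ (Om_a₁_subset_M₁ h.1 h.2.1 (closure_eq_top_iff.1 h.2.2))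

lemma ASat_Om_a₂_subset (h : IsReducedForm α β q' p₁' p₂') :
    ASat (Om a₂ (xPt α β)) ⊆ M₂ q' := by
  refine ASat_subset_M₂ ?_
  rw [Om_a₂_eq, ← swapX3_image_M₁]
  exact image_mono (Om_a₁_subset_M₁ h.1 h.2.1 (closure_eq_top_iff.1 h.2.2))

lemma ASat_Om_a₁_nonempty (hα : Irrational α) (hβ : Irrational β)
    (h : IsReducedForm β α q p₁ p₂) : (ASat (Om a₁ (xPt α β))).Nonempty :=
  ASat_nonempty (Om_a₁_nonempty hα hβ h.1 h.2.1 (closure_eq_top_iff.1 h.2.2))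

lemma ASat_Om_a₂_nonempty (hα : Irrational α) (hβ : Irrational β)
    (h : IsReducedForm α β q' p₁' p₂') : (ASat (Om a₂ (xPt α β))).Nonempty := by
  refine ASat_nonempty ?_
  rw [Om_a₂_eq]
  exact (Om_a₁_nonempty hβ hα h.1 h.2.1 (closure_eq_top_iff.1 h.2.2)).image _

lemma closure_orbit_diff (hα : Irrational α) (hβ : Irrational β)
    (h : IsReducedForm β α q p₁ p₂) (h' : IsReducedForm α β q' p₁' p₂') :
    closure (MulAction.orbit A (xPt α β)) \ MulAction.orbit A (xPt α β) =
      ASat (Om a₁ (xPt α β)) ∪ ASat (Om a₂ (xPt α β)) := by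
  refine Subset.antisymm (closure_orbit_diff_subset h.1 h.2.1) (subset_sdiff.2 ⟨?_, ?_⟩)
  · exact union_subset (ASat_Om_subset_closure a₁_mem_A _) (ASat_Om_subset_closure a₂_mem_A _)
  · exact (disjoint_orbit_xPt hα hβ h.1.ne' h'.1.ne').symm.mono_left
      (union_subset_union (ASat_Om_a₁_subset h) (ASat_Om_a₂_subset h'))

end reducedForms

/-! ### Irregularity -/

/-- A one-parameter subgroup of `A` whose nontrivial elements have distinct diagonal entries. -/
noncomputable def regularDiag (t : ℝ) : G :=
  ⟨Matrix.diagonal fun i => Real.exp (![t, 2 * t, -3 * t] i), by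
    rw [Matrix.det_diagonal, Fin.prod_univ_three, ← Real.exp_add, ← Real.exp_add,
      Real.exp_eq_one_iff]
    simp
    ring⟩

lemma coe_regularDiag (t : ℝ) : (regularDiag t : Matrix (Fin 3) (Fin 3) ℝ) =
    Matrix.diagonal fun i => Real.exp (![t, 2 * t, -3 * t] i) := rfl

lemma regularDiag_mem_A (t : ℝ) : regularDiag t ∈ A :=
  ⟨_, by simp [Fin.sum_univ_three]; ring, rfl⟩

lemma continuous_regularDiag : Continuous regularDiag := by
  refine Continuous.subtype_mk ?_ _
  refine Continuous.matrix_diagonal (continuous_pi fun i => ?_)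
  fin_cases i <;> simp <;> fun_prop

lemma regularDiag_add (s t : ℝ) : regularDiag (s + t) = regularDiag s * regularDiag t := by
  apply Subtype.ext
  rw [Matrix.SpecialLinearGroup.coe_mul]
  simp only [coe_regularDiag, Matrix.diagonal_mul_diagonal, ← Real.exp_add]
  congr 1
  ext i
  fin_cases i <;> simp <;> ring

lemma regularDiag_zero : regularDiag 0 = 1 := by
  have := regularDiag_add 0 0
  rw [add_zero] at this
  exact left_eq_mul.1 this

/-- An element of `G` that conjugates a diagonal matrix with distinct entries to a diagonal matrix
permutes the coordinate axes. -/
lemma exists_projConj_eq {g b : G} {t : ℝ} (ht : t ≠ 0) (hb : b ∈ A)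
    (h : regularDiag t * g = g * b) : ∃ j, projConj 2 g = projConj j 1 := by
  obtain ⟨s, -, hs⟩ := hb
  have hent : ∀ i j, g i j ≠ 0 → ![t, 2 * t, -3 * t] i = s j := by
    intro i j hij
    have := congrArg (fun k : G => (k : Matrix (Fin 3) (Fin 3) ℝ) i j) h
    simp only [Matrix.SpecialLinearGroup.coe_mul, coe_regularDiag, hs, Matrix.diagonal_mul,
      Matrix.mul_diagonal] at this
    rw [mul_comm] at this
    exact Real.exp_injective (mul_left_cancel₀ hij this)
  have hinv : ∀ r c, ∑ k, (g⁻¹ : G) r k * g k c = if r = c then 1 else 0 := by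
    intro r c
    have := congrFun (congrFun (coe_inv_mul_coe g) r) c
    rwa [Matrix.mul_apply, Matrix.one_apply] at this
  obtain ⟨j, hj⟩ : ∃ j, g 2 j ≠ 0 := by
    by_contra! hcon
    exact g.row_ne_zero 2 (funext hcon)
  have hcol : ∀ c, g 2 c ≠ 0 → g 0 c = 0 ∧ g 1 c = 0 := by
    intro c hc
    have h2 := hent 2 c hc
    constructor
    · by_contra h0
      have := (hent 0 c h0).trans h2.symm
      simp at this
      exact ht (by linarith)
    · by_contra h0
      have := (hent 1 c h0).trans h2.symm
      simp at this
      exact ht (by linarith)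
  have hrow : ∀ c, g 2 c ≠ 0 → ∀ r, (g⁻¹ : G) r 2 * g 2 c = if r = c then 1 else 0 := by
    intro c hc r
    have := hinv r c
    rwa [Fin.sum_univ_three, (hcol c hc).1, (hcol c hc).2, mul_zero, mul_zero, zero_add,
      zero_add] at this
  refine ⟨j, ?_⟩
  ext r c
  rw [projConj_apply, projConj_apply, inv_one, Matrix.SpecialLinearGroup.coe_one,
    Matrix.one_apply, Matrix.one_apply]
  by_cases hc : g 2 c = 0
  · have : j ≠ c := fun e => hj (e ▸ hc)
    simp [hc, this]
  · have hcj : c = j := by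
      by_contra hne
      have h1 := hrow c hc j
      rw [if_neg (Ne.symm hne)] at h1
      have h2 := hrow j hj j
      rw [if_pos rfl] at h2
      rcases mul_eq_zero.1 h1 with h0 | h0
      · rw [h0, zero_mul] at h2
        exact zero_ne_one h2
      · exact hc h0
    rw [hrow c hc r, hcj]
    simp

instance : Countable Gam := by
  have : Countable (Matrix.SpecialLinearGroup (Fin 3) ℤ) :=
    (Matrix.of.symm.injective.comp Subtype.coe_injective :
      Function.Injective fun g : Matrix.SpecialLinearGroup (Fin 3) ℤ =>
        Matrix.of.symm (g : Matrix (Fin 3) (Fin 3) ℤ)).countable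
  exact (Set.countable_range (Matrix.SpecialLinearGroup.map (Int.castRingHom ℝ) :
    Matrix.SpecialLinearGroup (Fin 3) ℤ → G)).to_subtype

/-- If the closure of `A x_v` were an orbit `L x_v`, then `L` would contain a `g` for which
`g x_v ∈ M⁽¹⁾_q`. For small `t` the point `g⁻¹ d(t) g x_v` of `L x_v` is in `A x_v`, because the
rest of the closure avoids a neighbourhood of `x_v`. As `Γ` is countable, for some `t ≠ 0` the
element `g⁻¹ d(t) g` is in `A` itself, so `g` permutes the axes, and then `g x_v ∉ M⁽¹⁾_q`. -/
lemma not_isRegularPt_xPt {α β : ℝ} (hα : Irrational α) (hβ : Irrational β)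
    {q q' : ℕ} {p₁ p₂ p₁' p₂' : ℤ}
    (h : IsReducedForm β α q p₁ p₂) (h' : IsReducedForm α β q' p₁' p₂') :
    ¬ IsRegularPt A (xPt α β) := by
  rintro ⟨L, -, hAL, hL⟩
  set x := xPt α β with hx
  have hdiff := closure_orbit_diff hα hβ h h'
  have hdisj := disjoint_orbit_xPt hα hβ h.1.ne' h'.1.ne'
  obtain ⟨y, hy⟩ := ASat_Om_a₁_nonempty hα hβ h
  have hyM := ASat_Om_a₁_subset h hy
  have hycl : y ∈ closure (MulAction.orbit A x) := ASat_Om_subset_closure a₁_mem_A _ hy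
  rw [hL] at hycl
  obtain ⟨⟨g, hg⟩, rfl⟩ := hycl
  have hyM : g • x ∈ M₁ q := hyM
  have hxM : x ∉ M₁ q ∪ M₂ q' := fun hmem => hdisj.le_bot ⟨MulAction.mem_orbit_self x, hmem⟩
  have hcl : IsClosed (M₁ q ∪ M₂ q') := (isClosed_M₁ h.1.ne').union (isClosed_M₂ h'.1.ne')
  have hcont : Continuous fun t : ℝ => (g⁻¹ * regularDiag t * g) • x :=
    Continuous.smul (f := fun t : ℝ => g⁻¹ * regularDiag t * g) (g := fun _ => x)
      ((continuous_const.mul continuous_regularDiag).mul continuous_const) continuous_const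
  have hev : ∀ᶠ t in 𝓝 (0 : ℝ), (g⁻¹ * regularDiag t * g) • x ∉ M₁ q ∪ M₂ q' := by
    refine hcont.continuousAt.eventually (hcl.isOpen_compl.mem_nhds ?_)
    simpa [regularDiag_zero] using hxM
  obtain ⟨δ, hδ, hball⟩ := Metric.eventually_nhds_iff_ball.1 hev
  rw [Real.ball_eq_Ioo, zero_sub, zero_add] at hball
  have hmem : ∀ t ∈ Ioo (-δ) δ, ∃ γ : Gam, ∃ a ∈ A,
      g⁻¹ * regularDiag t * g * hMat α β * γ = a * hMat α β := by
    intro t ht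
    have hcl' : (g⁻¹ * regularDiag t * g) • x ∈ closure (MulAction.orbit A x) := by
      rw [hL]
      exact ⟨⟨_, mul_mem (mul_mem (inv_mem hg) (hAL (regularDiag_mem_A t))) hg⟩, rfl⟩
    have horb : (g⁻¹ * regularDiag t * g) • x ∈ MulAction.orbit A x := by
      by_contra hno
      refine hball t ht (union_subset_union (ASat_Om_a₁_subset h) (ASat_Om_a₂_subset h') ?_)
      rw [← hdiff]
      exact ⟨hcl', hno⟩
    obtain ⟨a, ha⟩ := horb
    have ha : (a : G) • x = (g⁻¹ * regularDiag t * g) • x := ha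
    rw [hx, xPt, smul_smul, smul_smul, smul_eGam, smul_eGam] at ha
    obtain ⟨γ, hγ, e⟩ := (mk_eq_mk_iff _ _).1 ha.symm
    exact ⟨⟨γ, hγ⟩, a, a.2, e.symm⟩
  choose γ a ha e using hmem
  have hninj : ¬ Function.Injective fun t : Ioo (-δ) δ => γ t t.2 := by
    intro hinj
    have : (Ioo (-δ) δ).Countable := hinj.countable
    rw [Cardinal.Real.Ioo_countable_iff] at this
    linarith
  simp only [Function.Injective, not_forall] at hninj
  obtain ⟨⟨t, ht⟩, ⟨s, hs⟩, hts, hne⟩ := hninj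
  have hne' : t - s ≠ 0 := fun h0 => hne (Subtype.ext (sub_eq_zero.1 h0))
  have key : regularDiag (t - s) * g = g * (a t ht * (a s hs)⁻¹) := by
    have e1 := e t ht
    have e2 := e s hs
    simp only at hts
    rw [← hts] at e2
    have hsub : regularDiag t = regularDiag (t - s) * regularDiag s := by
      rw [← regularDiag_add, sub_add_cancel]
    rw [← mul_inv_eq_iff_eq_mul] at e1 e2
    rw [← e1, ← e2, hsub]
    group
  obtain ⟨j, hj⟩ := exists_projConj_eq hne' (mul_mem (ha t ht) (inv_mem (ha s hs))) key
  exact smul_xPt_notMem_M₁ hα hβ h.1.ne' hj hyM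

lemma IsReducedForm.neg {y x : ℝ} {q : ℕ} {p₁ p₂ : ℤ} (h : IsReducedForm y x q p₁ p₂) :
    IsReducedForm (-y) (-x) q p₁ (-p₂) := by
  obtain ⟨u, v, w, e⟩ := closure_eq_top_iff.1 h.2.2
  refine ⟨h.1, ?_, closure_eq_top_iff.2 ⟨u, -v, w, by linarith⟩⟩
  rw [h.2.1]
  push_cast
  ring

end AIrregular

theorem theorem3 (α β : ℝ) (hα : Irrational α) (hβ : Irrational β)
    (hdep : ¬ LinearIndependent ℚ ![(1 : ℝ), α, β]) :
    -- the two reduced forms exist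
    (∃ (q : ℕ) (p₁ p₂ : ℤ), AIrregular.IsReducedForm β α q p₁ p₂) ∧
    (∃ (q' : ℕ) (p₁' p₂' : ℤ), AIrregular.IsReducedForm α β q' p₁' p₂') ∧
    (∀ (q : ℕ) (p₁ p₂ : ℤ) (q' : ℕ) (p₁' p₂' : ℤ),
      AIrregular.IsReducedForm β α q p₁ p₂ → AIrregular.IsReducedForm α β q' p₁' p₂' →
      -- the orbits `M⁽¹⁾_q`, `M⁽²⁾_{q'}` are closed and disjoint from `A x_v`
      (IsClosed (AIrregular.M₁ q) ∧ IsClosed (AIrregular.M₂ q') ∧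
        Disjoint (MulAction.orbit AIrregular.A (AIrregular.xPt α β))
          (AIrregular.M₁ q ∪ AIrregular.M₂ q')) ∧
      -- divergence of `a_n x_v` away from the two rays
      (∀ a : ℕ → AIrregular.G, (∀ n, a n ∈ AIrregular.A) →
        Tendsto (fun n => AIrregular.distA (a n) AIrregular.rays) atTop atTop →
        ∀ φ : ℕ → ℕ, StrictMono φ → ∀ x : AIrregular.X3,
          ¬ Tendsto (fun n => a (φ n) • AIrregular.xPt α β) atTop (𝓝 x)) ∧
      -- description of the limit points of `A x_v`
      (closure (MulAction.orbit AIrregular.A (AIrregular.xPt α β)) \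
            MulAction.orbit AIrregular.A (AIrregular.xPt α β) =
          AIrregular.ASat (AIrregular.Om AIrregular.a₁ (AIrregular.xPt α β)) ∪
            AIrregular.ASat (AIrregular.Om AIrregular.a₂ (AIrregular.xPt α β)) ∧
        (AIrregular.ASat (AIrregular.Om AIrregular.a₁ (AIrregular.xPt α β))).Nonempty ∧
        (AIrregular.ASat (AIrregular.Om AIrregular.a₂ (AIrregular.xPt α β))).Nonempty) ∧
      (AIrregular.ASat (AIrregular.Om AIrregular.a₁ (AIrregular.xPt α β)) ⊆ AIrregular.M₁ q ∧
        AIrregular.ASat (AIrregular.Om AIrregular.a₂ (AIrregular.xPt α β)) ⊆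
          AIrregular.M₂ q')) ∧
    -- irregularity of `x_v` and `z_v`
    ¬ AIrregular.IsRegularPt AIrregular.A (AIrregular.xPt α β) ∧
    ¬ AIrregular.IsRegularPt AIrregular.A (AIrregular.zPt α β) := by
  have hdep' : ¬ LinearIndependent ℚ ![(1 : ℝ), β, α] := by
    rw [← linearIndependent_equiv (Equiv.swap (1 : Fin 3) 2)]
    convert hdep using 2
    ext i
    fin_cases i <;> simp [Equiv.swap_apply_def]
  obtain ⟨q, p₁, p₂, h⟩ := AIrregular.exists_isReducedForm hα hdep
  obtain ⟨q', p₁', p₂', h'⟩ := AIrregular.exists_isReducedForm hβ hdep'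
  refine ⟨⟨q, p₁, p₂, h⟩, ⟨q', p₁', p₂', h'⟩, ?_, ?_, ?_⟩
  · intro q p₁ p₂ q' p₁' p₂' h h'
    refine ⟨⟨AIrregular.isClosed_M₁ h.1.ne', AIrregular.isClosed_M₂ h'.1.ne',
      AIrregular.disjoint_orbit_xPt hα hβ h.1.ne' h'.1.ne'⟩, ?_,
      ⟨AIrregular.closure_orbit_diff hα hβ h h', AIrregular.ASat_Om_a₁_nonempty hα hβ h,
        AIrregular.ASat_Om_a₂_nonempty hα hβ h'⟩,
      AIrregular.ASat_Om_a₁_subset h, AIrregular.ASat_Om_a₂_subset h'⟩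
    intro a ha hd φ hφ x
    exact AIrregular.not_tendsto_of_distA h.1 h.2.1 ha hd hφ x
  · exact AIrregular.not_isRegularPt_xPt hα hβ h h'
  · intro hz
    exact AIrregular.not_isRegularPt_xPt hα.neg hβ.neg h.neg h'.neg
      (AIrregular.isRegularPt_xPt_of_zPt hz)
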